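/- Let $J=(J_1,\dots,J_n)'$ be an $n$-dimensional Lévy process: a càdlàg process with $J(0)=0$ and stationary, independent increments. Let $r\in\mathbb R^n$ with $r_j>0$ for all $j$, and let $P=(p_{ij})$ be a nonnegative $n\times n$ matrix with $\sum_j p_{ij}\le 1$ for every $i$, with $p_{ij}=0$ for $j\le i$, and such that each column of $P$ has at most one strictly positive entry (a *tree fluid network* $(J,r,P)$ with external input $J$, drain rates $r$ and routing matrix $P$). Let $w\in\mathbb R^n_+$ and let $(W,L)$ be the solution of the Skorokhod problem of $Y(t)=J(t)-(I-P')rt$ with reflection matrix $I-P'$ and initial condition $w$, that is, the càdlàg pair with (all relations componentwise) - $W(t)=w+Y(t)+(I-P')L(t)$ for $t\ge0$; - $W(t)\ge 0$ for $t\ge 0$ and $W(0)=w$; - $L(0)=0$ and $L$ is nondecreasing; - $\sum_{j}\int_0^\infty W_j(t)\,dL_j(t)=0$. For a process $V$ with values in $\mathbb R^n$, put $$B^V_j(t)=t-\sup\{s\le t: V_j(s)=0\},\qquad I^V_j(t)=t-\sup\{s\le t: V_j(s)\ne 0\},$$ where $s\ge 0$ and $\sup\emptyset=0$. Write $B=B^W$,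 $I=I^W$ (the ages of the busy and idle periods) and $\widetilde B=B^{\widetilde W}$, $\widetilde I=I^{\widetilde W}$ for the aggregated contents $\widetilde W=(I-P')^{-1}W$. Let $$X(t)=(I-P')^{-1}J(t)-rt,\qquad \overline X_k=\sup_{t\ge0}X_k(t),$$ $$G^X_k=\inf\{t\ge0: X_k(t)=\overline X_k\text{ or }X_k(t-)=\overline X_k\},\qquad H^X_k=\inf\Big\{t\ge0:\sup_{s\ge t}X_k(s)\ne X_k(t)\Big\},$$ with $\inf\emptyset=\infty$ in the definition of $H^X_k$. Suppose that - (T1) if $p_{ij}>0$, then $p_{ij}>r_j/r_i$; - (T2) $J_j$ is nondecreasing for $j=2,\dots,n$; - (T3) $J$ is an $n$-dimensional Lévy process (as stated above); - (T4) $J$ is integrable and $(I-P')^{-1}\mathbb E J(1)<r$ componentwise. Then: (i) for every initial condition $W(0)=w$, the triplet $(W(t),B(t),I(t))$ converges in distribution, as $t\to\infty$, to $((I-P')\overline X,G^X,H^X)$; (ii) if (T1) is only required with the weak inequality $p_{ij}\ge r_j/r_i$, then for every initial condition $W(0)=w$ the triplet $(W(t),\widetilde B(t),\widetilde I(t))$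 converges in distribution, as $t\to\infty$, to $((I-P')\overline X,G^X,H^X)$. Convergence in distribution is meant in $\mathbb R^n\times[0,\infty)^n\times[0,\infty]^n$. (The value $H^X_k=\infty$ occurs with positive probability only if $X_k$ is almost surely nonincreasing.) -/

import Mathlib

open MeasureTheory ProbabilityTheory Filter Topology Set
open scoped NNReal ENNReal Matrix

/-- Right-continuous paths with left limits, on the time axis `[0, ∞)`
(at time `0` the left limit is void, since `𝓝[<] 0 = ⊥`). -/
def IsCadlag {E : Type*} [TopologicalSpace E] (f : ℝ≥0 → E) : Prop :=
  ∀ t, ContinuousWithinAt f (Ici t) t ∧ ∃ l, Tendsto f (𝓝[<] t) (𝓝 l)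

/-- An `n`-dimensional Lévy process: starts at `0`, has independent and stationary increments and
càdlàg paths (almost surely). -/
structure IsLevyProcess {Ω : Type*} [MeasurableSpace Ω] {n : ℕ}
    (J : ℝ≥0 → Ω → Fin n → ℝ) (μ : Measure Ω) : Prop where
  measurable : ∀ t, Measurable (J t)
  zero : ∀ᵐ ω ∂μ, J 0 ω = 0
  indep : HasIndepIncrements J μ
  stationary : ∀ s t, IdentDistrib (fun ω => J (s + t) ω - J s ω) (J t) μ μ
  cadlag : ∀ᵐ ω ∂μ, IsCadlag (fun t => J t ω)

/-- `(W, L)` solves the Skorokhod problem of the path `Y` in the nonnegative orthant, with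
reflection matrix `R` and initial condition `w`. The measure of a Stieltjes function on `ℝ≥0`
does not charge `{0}`, in accordance with `L(0) = 0`. -/
structure IsSkorokhodSolution {n : ℕ} (R : Matrix (Fin n) (Fin n) ℝ) (w : Fin n → ℝ)
    (Y W L : ℝ≥0 → Fin n → ℝ) : Prop where
  cadlag_W : IsCadlag W
  cadlag_L : IsCadlag L
  eq : ∀ t, W t = w + Y t + R *ᵥ L t
  nonneg : ∀ t, 0 ≤ W t
  initial : W 0 = w
  L_zero : L 0 = 0
  L_mono : Monotone L
  /-- `∑ⱼ ∫₀^∞ Wⱼ(t) dLⱼ(t) = 0`, with `F j` the `j`-th coordinate of `L` seen as a Stieltjes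
  function. -/
  complementarity : ∃ F : Fin n → StieltjesFunction ℝ≥0, (∀ j t, F j t = L t j) ∧
    ∑ j, ∫⁻ t, ENNReal.ofReal (W t j) ∂(F j).measure = 0

/-- The Lévy-driven tree fluid network `(J, r, P)`: external input `J`, drain rates `r`,
routing matrix `P`. -/
structure IsTreeFluidNetwork {Ω : Type*} [MeasurableSpace Ω] {n : ℕ} (μ : Measure Ω)
    (J : ℝ≥0 → Ω → Fin n → ℝ) (r : Fin n → ℝ) (P : Matrix (Fin n) (Fin n) ℝ) : Prop where
  levy : IsLevyProcess J μ
  rate_pos : ∀ j, 0 < r j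
  nonneg : ∀ i j, 0 ≤ P i j
  row_sum_le : ∀ i, ∑ j, P i j ≤ 1
  /-- No self-loops, and no routing to stations with a smaller label. -/
  upper : ∀ i j, j ≤ i → P i j = 0
  /-- At most one station feeds station `j`. -/
  feeder_unique : ∀ i i' j, 0 < P i j → 0 < P i' j → i = i'

/-- The path `Y(t) = J(t) - (I - P') r t` of a fluid network; `J` is a path of the input. -/
def netInput {n : ℕ} (r : Fin n → ℝ) (P : Matrix (Fin n) (Fin n) ℝ)
    (J : ℝ≥0 → Fin n → ℝ) (t : ℝ≥0) : Fin n → ℝ :=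
  J t - (t : ℝ) • ((1 - Pᵀ) *ᵥ r)

/-- The path `X(t) = (I - P')⁻¹ J(t) - r t`; `J` is a path of the input. -/
noncomputable def netFree {n : ℕ} (r : Fin n → ℝ) (P : Matrix (Fin n) (Fin n) ℝ)
    (J : ℝ≥0 → Fin n → ℝ) (t : ℝ≥0) : Fin n → ℝ :=
  (1 - Pᵀ)⁻¹ *ᵥ J t - (t : ℝ) • r

/-- The aggregated contents `(I - P')⁻¹ W(t)`. -/
noncomputable def aggregate {n : ℕ} (P : Matrix (Fin n) (Fin n) ℝ)
    (W : ℝ≥0 → Fin n → ℝ) (t : ℝ≥0) : Fin n → ℝ :=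
  (1 - Pᵀ)⁻¹ *ᵥ W t

/-- Ages of the busy periods: `Bⱼ(t) = t - sup {s ≤ t : Wⱼ(s) = 0}`, with `sup ∅ = 0`. -/
noncomputable def busyAge {n : ℕ} (W : ℝ≥0 → Fin n → ℝ) (t : ℝ≥0) : Fin n → ℝ≥0 :=
  fun j => t - sSup {s | s ≤ t ∧ W s j = 0}

/-- Ages of the idle periods: `Iⱼ(t) = t - sup {s ≤ t : Wⱼ(s) ≠ 0}`, with `sup ∅ = 0`. They are
regarded as elements of `[0, ∞]`, the range of the limit `lastPassageStart`. -/
noncomputable def idleAge {n : ℕ} (W : ℝ≥0 → Fin n → ℝ) (t : ℝ≥0) : Fin n → ℝ≥0∞ :=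
  fun j => ((t - sSup {s | s ≤ t ∧ W s j ≠ 0} : ℝ≥0) : ℝ≥0∞)

/-- The all-time maxima `sup_{t ≥ 0} Xₖ(t)`; meaningful for paths bounded above. -/
noncomputable def pathMax {n : ℕ} (X : ℝ≥0 → Fin n → ℝ) : Fin n → ℝ :=
  fun k => ⨆ t, X t k

/-- `Gₖ`: the first epoch at which `Xₖ(t)` or `Xₖ(t-)` equals the all-time maximum of `Xₖ`. -/
noncomputable def maxEpoch {n : ℕ} (X : ℝ≥0 → Fin n → ℝ) : Fin n → ℝ≥0 :=
  fun k => sInf {t | X t k = pathMax X k ∨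
    (0 < t ∧ Tendsto (fun s => X s k) (𝓝[<] t) (𝓝 (pathMax X k)))}

/-- `Hₖ = inf {t ≥ 0 : sup_{s ≥ t} Xₖ(s) ≠ Xₖ(t)}`, the beginning of the first last-passage
excursion, with `inf ∅ = ∞` (which happens exactly for nonincreasing `Xₖ`). -/
noncomputable def lastPassageStart {n : ℕ} (X : ℝ≥0 → Fin n → ℝ) : Fin n → ℝ≥0∞ :=
  fun k => sInf ((fun t : ℝ≥0 => (t : ℝ≥0∞)) '' {t | (⨆ s : Ici t, X s k) ≠ X t k})

/-! Multiplying by `(1 - Pᵀ)⁻¹` decouples the network: each aggregated content is its free path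
`freeContent`, a constant plus a coordinate of the Lévy process `X`, plus its own regulator. By
induction along the tree, that regulator is the one-sided regulator of the free path
(`IsSkorokhodSolution.eq_regulator`). The reason is that what a station receives besides its
feeder's lost outflow is nondecreasing, so idleness of the feeder can be replaced by the feeder's
free path (`regulator_feed`).

The aggregated content at `t` is therefore `max (c + X t) (sup_{s ≤ t} (X t - X s))`, a functional
of the path reversed from `t`; its busy and idle ages are such functionals too. Reversal preserves
the law of the increments (`IsLevyProcess.map_reversed`), so the triplet at time `t` has the law of
the same functional of `X` stopped at `t`. Since `X` drifts to `-∞` (`IsLevyProcess.tendsto_atBot`),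
the functional of the stopped path converges almost surely to the maximum, its first epoch and the
first last-passage start. All functionals use a countable dense set of times only, which makes them
measurable.

For the ages of `W` itself, a station may be empty while its aggregated content is positive. With
strict rates this happens only where the aggregated content has left limit zero and jumps up;
quasi-left-continuity makes such times limits of genuine zeros (`IsLevyProcess.ae_zerosAccumulate`),
so busy ages agree. Idle ages agree because a station that stays empty has an empty feeder, except
possibly at `t` itself, where almost surely there is no upward jump. -/

/-! ### Càdlàg paths. -/

theorem IsCadlag.apply {n : ℕ} {f : ℝ≥0 → Fin n → ℝ} (hf : IsCadlag f) (k : Fin n) :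
    IsCadlag fun t => f t k := by
  intro t
  obtain ⟨h1, l, hl⟩ := hf t
  exact ⟨(continuous_apply k).continuousAt.comp_continuousWithinAt h1, l k,
    ((continuous_apply k).tendsto l).comp hl⟩

theorem IsCadlag.comp_continuous {E F : Type*} [TopologicalSpace E] [TopologicalSpace F]
    {f : ℝ≥0 → E} (hf : IsCadlag f) {g : E → F} (hg : Continuous g) :
    IsCadlag fun t => g (f t) := by
  intro t
  obtain ⟨h1, l, hl⟩ := hf t
  exact ⟨hg.continuousAt.comp_continuousWithinAt h1, g l, (hg.tendsto l).comp hl⟩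

theorem IsCadlag.add {E : Type*} [TopologicalSpace E] [Add E] [ContinuousAdd E]
    {f g : ℝ≥0 → E} (hf : IsCadlag f) (hg : IsCadlag g) : IsCadlag fun t => f t + g t := by
  intro t
  obtain ⟨h1, l, hl⟩ := hf t
  obtain ⟨h2, m, hm⟩ := hg t
  exact ⟨h1.add h2, l + m, hl.add hm⟩

theorem Continuous.isCadlag {E : Type*} [TopologicalSpace E] {f : ℝ≥0 → E} (hf : Continuous f) :
    IsCadlag f := fun t =>
  ⟨hf.continuousWithinAt, f t, hf.continuousAt.mono_left nhdsWithin_le_nhds⟩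

theorem IsCadlag.neg {y : ℝ≥0 → ℝ} (hy : IsCadlag y) : IsCadlag fun t => - y t :=
  hy.comp_continuous continuous_neg

theorem IsCadlag.exists_gt_near {y : ℝ≥0 → ℝ} (hy : IsCadlag y) {t : ℝ≥0} {C : ℝ} (h : y t < C) :
    ∃ u > t, ∀ s, t ≤ s → s < u → y s < C := by
  have h1 : ∀ᶠ s in 𝓝[≥] t, y s < C := (hy t).1.eventually_lt_const h
  obtain ⟨u, hu, hs⟩ := (mem_nhdsGE_iff_exists_Ico_subset.1 h1)
  exact ⟨u, hu, fun s h1 h2 => hs ⟨h1, h2⟩⟩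

theorem IsCadlag.exists_lt_near {y : ℝ≥0 → ℝ} (hy : IsCadlag y) {t : ℝ≥0} {C : ℝ} (h : C < y t) :
    ∃ u > t, ∀ s, t ≤ s → s < u → C < y s := by
  obtain ⟨u, hu, H⟩ := hy.neg.exists_gt_near (t := t) (C := -C) (by simpa using h)
  exact ⟨u, hu, fun s h1 h2 => by simpa using H s h1 h2⟩

theorem IsCadlag.exists_bound {y : ℝ≥0 → ℝ} (hy : IsCadlag y) (t : ℝ≥0) :
    ∃ C, ∀ s ≤ t, |y s| ≤ C := by
  have hc : IsCompact (Icc 0 t) := isCompact_Icc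
  have := hc.induction_on (p := fun S => ∃ C, ∀ s ∈ S, |y s| ≤ C) ⟨0, by simp⟩
    (fun S T hST ⟨C, hC⟩ => ⟨C, fun s hs => hC s (hST hs)⟩)
    (fun S T ⟨C, hC⟩ ⟨D, hD⟩ => ⟨max C D, fun s hs => hs.elim
      (fun h => (hC s h).trans (le_max_left _ _)) (fun h => (hD s h).trans (le_max_right _ _))⟩) ?_
  · obtain ⟨C, hC⟩ := this
    exact ⟨C, fun s hs => hC s ⟨zero_le, hs⟩⟩
  intro s _
  obtain ⟨h1, l, hl⟩ := hy s
  have e1 : ∀ᶠ v in 𝓝[≥] s, |y v| < |y s| + |l| + 1 :=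
    h1.abs.eventually_lt_const (by linarith [abs_nonneg l, abs_nonneg (y s)])
  have e2 : ∀ᶠ v in 𝓝[<] s, |y v| < |y s| + |l| + 1 :=
    hl.abs.eventually_lt_const (by linarith [abs_nonneg l, abs_nonneg (y s)])
  have e : ∀ᶠ v in 𝓝 s, |y v| < |y s| + |l| + 1 := by
    rw [← nhdsLT_sup_nhdsGE]
    exact eventually_sup.2 ⟨e2, e1⟩
  exact ⟨_, mem_nhdsWithin_of_mem_nhds e, _, fun v hv => le_of_lt hv⟩

/-- A càdlàg path whose values and left limits on `[a, b]` stay above `m` is bounded away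
from `m` on `[a, b]`. -/
theorem IsCadlag.exists_gap {y : ℝ≥0 → ℝ} (hy : IsCadlag y) {a b : ℝ≥0} {m : ℝ}
    (h : ∀ v ∈ Icc a b, m < y v) (hl : ∀ v ∈ Ioc a b, ¬ Tendsto y (𝓝[<] v) (𝓝 m)) :
    ∃ δ > 0, ∀ v ∈ Icc a b, m + δ ≤ y v := by
  have hc : IsCompact (Icc a b) := isCompact_Icc
  refine hc.induction_on (p := fun S => ∃ δ > 0, ∀ s ∈ S, m + δ ≤ y s) ⟨1, by simp⟩
    (fun S T hST ⟨C, h0, hC⟩ => ⟨C, h0, fun s hs => hC s (hST hs)⟩)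
    (fun S T ⟨C, h0, hC⟩ ⟨D, h0', hD⟩ => ⟨min C D, lt_min h0 h0', fun s hs => hs.elim
      (fun h => (add_le_add_right (min_le_left _ _) m).trans (hC s h))
      (fun h => (add_le_add_right (min_le_right _ _) m).trans (hD s h))⟩) ?_
  intro v hv
  obtain ⟨h1, l, hl'⟩ := hy v
  have hm := h v hv
  have e1 : ∀ᶠ s in 𝓝[≥] v, (m + y v) / 2 < y s := h1.eventually_const_lt (by linarith)
  rcases hv.1.eq_or_lt with rfl | hav
  · refine ⟨_, ?_, (y a - m) / 2, by linarith, fun s (hs : (m + y a) / 2 < y s) => by linarith⟩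
    exact nhdsWithin_mono a Icc_subset_Ici_self e1
  have hne : l ≠ m := fun h => hl v ⟨hav, hv.2⟩ (h ▸ hl')
  have hne' : (𝓝[<] v).NeBot := nhdsLT_neBot_of_exists_lt ⟨a, hav⟩
  have hml : m ≤ l := by
    refine ge_of_tendsto hl' ?_
    filter_upwards [Ioo_mem_nhdsLT hav] with s hs
    exact (h s ⟨hs.1.le, hs.2.le.trans hv.2⟩).le
  have hml' : m < l := lt_of_le_of_ne hml (Ne.symm hne)
  have e2 : ∀ᶠ s in 𝓝[<] v, (m + l) / 2 < y s := hl'.eventually_const_lt (by linarith)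
  have e : ∀ᶠ s in 𝓝 v, min ((m + l) / 2) ((m + y v) / 2) < y s := by
    rw [← nhdsLT_sup_nhdsGE]
    exact eventually_sup.2 ⟨e2.mono fun s hs => (min_le_left _ _).trans_lt hs,
      e1.mono fun s hs => (min_le_right _ _).trans_lt hs⟩
  refine ⟨_, mem_nhdsWithin_of_mem_nhds e, min ((m + l) / 2) ((m + y v) / 2) - m, ?_,
    fun s hs => ?_⟩
  · have : m < min ((m + l) / 2) ((m + y v) / 2) := lt_min (by linarith) (by linarith)
    linarith
  · have : min ((m + l) / 2) ((m + y v) / 2) < y s := hs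
    linarith

/-! ### One-sided reflection and its uniqueness. -/

/-- The regulator `sup_{s ≤ t} max (0, -y s)` of one-sided reflection at `0`. -/
noncomputable def regulator (y : ℝ≥0 → ℝ) (t : ℝ≥0) : ℝ := ⨆ s : Iic t, max 0 (- y s)

/-- The one-sided reflection of `y` at `0`. -/
noncomputable def reflected (y : ℝ≥0 → ℝ) (t : ℝ≥0) : ℝ := y t + regulator y t

theorem IsCadlag.bddAbove_regulator {y : ℝ≥0 → ℝ} (hy : IsCadlag y) (t : ℝ≥0) :
    BddAbove (range fun s : Iic t => max 0 (- y s)) := by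
  obtain ⟨C, hC⟩ := hy.exists_bound t
  refine ⟨max 0 C, ?_⟩
  rintro _ ⟨s, rfl⟩
  exact max_le_max le_rfl ((neg_le_abs _).trans (hC s s.2))

theorem regulator_nonneg (y : ℝ≥0 → ℝ) (t : ℝ≥0) : 0 ≤ regulator y t :=
  Real.iSup_nonneg fun _ => le_max_left _ _

theorem IsCadlag.neg_le_regulator {y : ℝ≥0 → ℝ} (hy : IsCadlag y) {s t : ℝ≥0} (h : s ≤ t) :
    - y s ≤ regulator y t :=
  (le_max_right _ _).trans (le_ciSup (hy.bddAbove_regulator t) ⟨s, h⟩)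

theorem regulator_le {y : ℝ≥0 → ℝ} {t : ℝ≥0} {C : ℝ} (hC : 0 ≤ C) (h : ∀ s ≤ t, - y s ≤ C) :
    regulator y t ≤ C := by
  have : Nonempty (Iic t) := ⟨⟨t, self_mem_Iic⟩⟩
  exact ciSup_le fun s => max_le hC (h s s.2)

theorem IsCadlag.regulator_mono {y : ℝ≥0 → ℝ} (hy : IsCadlag y) : Monotone (regulator y) :=
  fun _ t hst => regulator_le (regulator_nonneg y t) fun _ hv => hy.neg_le_regulator (hv.trans hst)

theorem IsCadlag.reflected_nonneg {y : ℝ≥0 → ℝ} (hy : IsCadlag y) (t : ℝ≥0) :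
    0 ≤ reflected y t := by
  have := hy.neg_le_regulator (le_refl t)
  unfold reflected
  linarith

/-- The running regulator grows only at zeros of the reflected path. -/
theorem IsCadlag.exists_reflected_eq_zero {y : ℝ≥0 → ℝ} (hy : IsCadlag y) {v t : ℝ≥0}
    (h : regulator y v < regulator y t) : ∃ s ∈ Ioc v t, reflected y s = 0 := by
  -- The zero is the first time `s0` at which `-y` passes an intermediate level `m`: by right
  -- continuity `m ≤ -y s0`, so `s0` lies after `v`, and there `-y` is its own running maximum.
  obtain ⟨m, hm1, hm2⟩ := exists_between h
  have hm0 : 0 ≤ m := (regulator_nonneg y v).trans hm1.le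
  have hex : ∃ s ≤ t, m < - y s := by
    by_contra hcon
    push Not at hcon
    exact hm2.not_ge (regulator_le hm0 hcon)
  obtain ⟨s1, hs1, hs1'⟩ := hex
  set S := {s | m < - y s} with hS
  have hne : S.Nonempty := ⟨s1, hs1'⟩
  set s0 := sInf S with hs0
  have hlt : ∀ s < s0, - y s ≤ m := fun s hs => by
    by_contra hc
    exact (notMem_of_lt_csInf hs (OrderBot.bddBelow S)) (not_le.1 hc)
  have h0 : m ≤ - y s0 := by
    by_contra hc
    obtain ⟨u, hu, H⟩ := hy.neg.exists_gt_near (not_le.1 hc)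
    obtain ⟨s, hsS, hsu⟩ := exists_lt_of_csInf_lt hne (show sInf S < u from hu)
    exact lt_asymm (H s (csInf_le (OrderBot.bddBelow S) hsS) hsu) hsS
  refine ⟨s0, ⟨?_, (csInf_le (OrderBot.bddBelow S) hs1').trans hs1⟩, ?_⟩
  · by_contra hc
    have := hy.neg_le_regulator (not_lt.1 hc)
    linarith
  · have : regulator y s0 = - y s0 := by
      refine le_antisymm (regulator_le (hm0.trans h0) fun s hs => ?_) (hy.neg_le_regulator le_rfl)
      rcases hs.eq_or_lt with rfl | hs
      · exact le_rfl
      · exact (hlt s hs).trans h0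
    simp [reflected, this]

theorem IsCadlag.regulator_eq_of_pos {y : ℝ≥0 → ℝ} (hy : IsCadlag y) {v t : ℝ≥0} (hvt : v ≤ t)
    (h : ∀ s ∈ Ioc v t, reflected y s ≠ 0) : regulator y v = regulator y t := by
  refine le_antisymm (hy.regulator_mono hvt) (not_lt.1 fun hc => ?_)
  obtain ⟨s, hs, hs'⟩ := hy.exists_reflected_eq_zero hc
  exact h s hs hs'

theorem IsCadlag.regulator_rightCts {y : ℝ≥0 → ℝ} (hy : IsCadlag y) {t : ℝ≥0} {C : ℝ}
    (h : regulator y t < C) : ∃ u > t, ∀ s, s < u → regulator y s < C := by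
  obtain ⟨C', h1, h2⟩ := exists_between h
  obtain ⟨u, hu, H⟩ := hy.neg.exists_gt_near (t := t) (C := C')
    ((hy.neg_le_regulator le_rfl).trans_lt h1)
  refine ⟨u, hu, fun s hs => (regulator_le ((regulator_nonneg y t).trans h1.le) fun v hv => ?_).trans_lt h2⟩
  rcases le_or_gt v t with hvt | hvt
  · exact (hy.neg_le_regulator hvt).trans h1.le
  · exact (H v hvt.le (hv.trans_lt hs)).le

theorem IsCadlag.reflected_isCadlag {y : ℝ≥0 → ℝ} (hy : IsCadlag y) : IsCadlag (reflected y) := by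
  refine hy.add fun t => ⟨?_, ?_⟩
  · refine tendsto_order.2 ⟨fun a ha => ?_, fun b hb => ?_⟩
    · filter_upwards [self_mem_nhdsWithin] with s hs
      exact ha.trans_le (hy.regulator_mono hs)
    · obtain ⟨u, hu, H⟩ := hy.regulator_rightCts hb
      filter_upwards [mem_nhdsWithin_of_mem_nhds (Iio_mem_nhds hu)] with s hs using H s hs
  · exact ⟨_, hy.regulator_mono.tendsto_nhdsLT t⟩

/-- Uniqueness for the one-dimensional Skorokhod problem. -/
theorem eq_regulator_of_complementarity {y : ℝ≥0 → ℝ} (hy : IsCadlag y)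
    (F : StieltjesFunction ℝ≥0) (hF0 : F 0 = 0) (hnn : ∀ t, 0 ≤ y t + F t)
    (hc : ∫⁻ t, ENNReal.ofReal (y t + F t) ∂F.measure = 0) (hmeas : Measurable y) (t : ℝ≥0) :
    F t = regulator y t := by
  -- Complementarity: `dF` does not charge the times of positive content.
  have hnull : F.measure {s | 0 < y s + F s} = 0 := by
    have hm : Measurable fun s => ENNReal.ofReal (y s + F s) :=
      (hmeas.add F.mono.measurable).ennreal_ofReal
    have := (lintegral_eq_zero_iff hm).1 hc
    have h2 : {s | 0 < y s + F s} = {s | ¬ ENNReal.ofReal (y s + F s) = (0 : ℝ≥0 → ℝ≥0∞) s} := by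
      ext s; simp
    rw [h2]
    exact this
  refine le_antisymm (not_lt.1 fun hlt => ?_) (regulator_le ?_ fun s hs => ?_)
  -- If `F` passed the level `C`, content would be positive on `S` up to `t`, so `F` could not grow
  -- there; yet it has to climb past `C` at or after `a`.
  · set C := regulator y t with hC
    have hC0 : 0 ≤ C := regulator_nonneg y t
    set S := {s | C < F s} with hS
    have hpos : ∀ s ∈ S, s ≤ t → 0 < y s + F s := fun s hs hst => by
      have := hy.neg_le_regulator hst
      have : C < F s := hs
      linarith
    have hne : S.Nonempty := ⟨t, hlt⟩
    set a := sInf S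
    have hbelow : ∀ s < a, F s ≤ C := fun s hs => by
      by_contra hc
      exact (notMem_of_lt_csInf hs (OrderBot.bddBelow S)) (not_le.1 hc)
    have habove : ∀ s, a < s → s ∈ S := fun s hs => by
      obtain ⟨s', hs', h2⟩ := exists_lt_of_csInf_lt hne hs
      exact lt_of_lt_of_le hs' (F.mono h2.le)
    have hat : a ≤ t := csInf_le (OrderBot.bddBelow S) hlt
    -- If `F` jumps over `C` at `a`, the atom at `a` must be included, hence `Icc` and the left
    -- limit; `F 0 = 0` excludes `a = 0`.
    by_cases ha : a ∈ S
    · have h0 : F.measure (Icc a t) = 0 := measure_mono_null (fun s hs => hpos s (by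
        rcases hs.1.eq_or_lt with h | h
        · exact h ▸ ha
        · exact habove s h) hs.2) hnull
      rw [F.measure_Icc, ENNReal.ofReal_eq_zero] at h0
      have ha0 : 0 < a := by
        rw [pos_iff_ne_zero]
        intro h
        have : C < F a := ha
        rw [h, hF0] at this
        linarith
      have : Function.leftLim F a ≤ C := by
        have hne' : (𝓝[<] a).NeBot := nhdsLT_neBot_of_exists_lt ⟨0, ha0⟩
        refine le_of_tendsto (F.mono.tendsto_leftLim a) ?_
        filter_upwards [self_mem_nhdsWithin] with s hs using hbelow s hs
      linarith
    · have h0 : F.measure (Ioc a t) = 0 := measure_mono_null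
        (fun s hs => hpos s (habove s hs.1) hs.2) hnull
      rw [F.measure_Ioc, ENNReal.ofReal_eq_zero] at h0
      have : F a ≤ C := not_lt.1 ha
      linarith
  · rw [← hF0]; exact F.mono zero_le
  · have := hnn s
    have := F.mono hs
    linarith

/-- Right continuity suffices: `y` is the pointwise limit of its samples at the right ends of cells
of mesh `1 / (n + 1)`. -/
theorem IsCadlag.measurable {y : ℝ≥0 → ℝ} (hy : IsCadlag y) : Measurable y := by
  let a : ℕ → ℝ≥0 → ℝ≥0 := fun n t => ((⌊(n + 1 : ℝ≥0) * t⌋₊ : ℝ≥0) + 1) / (n + 1)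
  refine measurable_of_tendsto_metrizable (f := fun n t => y (a n t)) (fun n => ?_) ?_
  · have h : Measurable fun t : ℝ≥0 => ⌊(n + 1 : ℝ≥0) * t⌋₊ :=
      Nat.measurable_floor.comp (measurable_const.mul measurable_id)
    exact (measurable_from_nat (f := fun k : ℕ => y (((k : ℝ≥0) + 1) / (n + 1)))).comp h
  · refine tendsto_pi_nhds.2 fun t => ?_
    have hge : ∀ n, t ≤ a n t := fun n => by
      rw [le_div_iff₀ (by positivity), mul_comm]
      exact (Nat.lt_floor_add_one _).le
    have hle : ∀ n : ℕ, a n t ≤ t + 1 / (n + 1) := fun n => by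
      rw [div_le_iff₀ (by positivity), add_mul t, div_mul_cancel₀ _ (by positivity), mul_comm t]
      gcongr
      exact Nat.floor_le zero_le
    have h1 : Tendsto (fun n => a n t) atTop (𝓝 t) := by
      refine tendsto_of_tendsto_of_tendsto_of_le_of_le tendsto_const_nhds ?_ hge hle
      have : Tendsto (fun n : ℕ => 1 / ((n : ℝ≥0) + 1)) atTop (𝓝 0) :=
        tendsto_one_div_add_atTop_nhds_zero_nat
      simpa using this.const_add t
    exact (hy t).1.tendsto.comp
      (tendsto_nhdsWithin_iff.2 ⟨h1, Eventually.of_forall fun n => hge n⟩)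

theorem IsCadlag.regulator_isCadlag {y : ℝ≥0 → ℝ} (hy : IsCadlag y) : IsCadlag (regulator y) := by
  have := hy.reflected_isCadlag.add hy.neg
  have e : (fun s => reflected y s + - y s) = regulator y := funext fun s => by simp [reflected]
  rwa [e] at this

/-! ### A station fed by a reflected path. -/

/-- Feeding a station with the outflow of a reflected path has the same regulator as feeding it
with the free path, provided that the remaining input `A` is nondecreasing. -/
theorem regulator_feed {A u : ℝ≥0 → ℝ} (hA : Monotone A) (hA0 : 0 ≤ A 0) (hAc : IsCadlag A)
    (hu : IsCadlag u) {p : ℝ} (hp : 0 ≤ p) (t : ℝ≥0) :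
    regulator (fun s => A s - p * regulator u s) t = regulator (fun s => A s + p * u s) t := by
  have hreg := hu.regulator_isCadlag
  have h1 : IsCadlag fun s => A s - p * regulator u s := by
    simpa [sub_eq_add_neg] using
      hAc.add (hreg.comp_continuous (g := fun x => -(p * x)) (by fun_prop))
  have h2 : IsCadlag fun s => A s + p * u s :=
    hAc.add (hu.comp_continuous (g := fun x => p * x) (by fun_prop))
  set C := regulator (fun s => A s + p * u s) t
  have hC : 0 ≤ C := regulator_nonneg _ _
  refine le_antisymm (regulator_le hC fun s hs => ?_)
    (regulator_le (regulator_nonneg _ _) fun s hs => ?_)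
  · have hAs : 0 ≤ A s := hA0.trans (hA zero_le)
    rcases hp.eq_or_lt with rfl | hp
    · linarith
    -- For `v ≤ s` the bound `-p * u v ≤ C + A v` can be weakened to `C + A s`; this is where `A`
    -- must be nondecreasing.
    have : regulator u s ≤ (C + A s) / p := regulator_le (by positivity) fun v hv => by
      rw [le_div_iff₀ hp]
      have := h2.neg_le_regulator (hv.trans hs)
      have := hA hv
      linarith
    rw [le_div_iff₀ hp] at this
    linarith
  · refine le_trans ?_ (h1.neg_le_regulator hs)
    have := mul_le_mul_of_nonneg_left (hu.neg_le_regulator (le_refl s)) hp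
    linarith

section Feed

variable {A u : ℝ≥0 → ℝ} {p κ : ℝ}

/-- If a fed station empties while its feeder does not, then both were empty just before. -/
theorem tendsto_reflected_of_feed (hu : IsCadlag u) (hy : IsCadlag fun s => A s + p * u s)
    (hp : 0 < p) (hκ : 0 < κ) (hA : ∀ s t : ℝ≥0, s ≤ t → κ * (t - s) ≤ A t - A s)
    (hV : ∀ s, 0 ≤ A s - p * regulator u s + regulator (fun s => A s + p * u s) s) {s : ℝ≥0}
    (hs : 0 < s) (h0 : A s - p * regulator u s + regulator (fun s => A s + p * u s) s = 0)
    (hne : reflected (fun s => A s + p * u s) s ≠ 0) :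
    Tendsto (reflected fun s => A s + p * u s) (𝓝[<] s) (𝓝 0) := by
  set y : ℝ≥0 → ℝ := fun s => A s + p * u s with hydef
  set V : ℝ≥0 → ℝ := fun s => A s - p * regulator u s + regulator y s with hVdef
  -- Aggregated content is the station's own content `V` plus `p` times the feeder's.
  have hdec : ∀ v, reflected y v = V v + p * reflected u v := fun v => by
    simp only [reflected, hydef, hVdef]; ring
  have hVs : V s = 0 := h0
  have hVnn : ∀ v, 0 ≤ V v := hV
  have hus : 0 < reflected u s := by
    refine lt_of_le_of_ne (hu.reflected_nonneg s) fun h => hne ?_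
    rw [hdec, hVs, ← h]; simp
  have hNB : (𝓝[<] s).NeBot := nhdsLT_neBot_of_exists_lt ⟨0, hs⟩
  have hle : ∀ v ≤ s, regulator u v ≤ regulator u s := fun v hv => hu.regulator_mono hv
  -- The feeder is not empty at `s`, so its regulator is left-continuous there: a jump would force
  -- `regulator u s = -u s`.
  have hleft : ∀ ε > 0, ∃ v < s, regulator u s - ε < regulator u v := by
    intro ε hε
    by_contra hcon
    push Not at hcon
    have hb : regulator u s ≤ max (- u s) (regulator u s - ε) := by
      refine regulator_le (le_max_of_le_right ((regulator_nonneg u 0).trans (hcon 0 hs)))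
        fun v hv => ?_
      rcases hv.eq_or_lt with rfl | hv
      · exact le_max_left _ _
      · exact le_max_of_le_right ((hu.neg_le_regulator le_rfl).trans (hcon v hv))
    rcases le_max_iff.1 hb with h | h
    · simp only [reflected] at hus; linarith
    · linarith
  -- `V v ≤ V s + p * (regulator u s - regulator u v)`, because `A` and the regulator of `y` are
  -- nondecreasing.
  have hVlim : Tendsto V (𝓝[<] s) (𝓝 0) := by
    refine tendsto_order.2 ⟨fun a ha => Eventually.of_forall fun v => ha.trans_le (hVnn v),
      fun b hb => ?_⟩
    obtain ⟨v0, hv0, h⟩ := hleft (b / p) (by positivity)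
    filter_upwards [Ioo_mem_nhdsLT hv0] with v hv
    have h1 := hu.regulator_mono hv.1.le
    have h2 := hA v s hv.2.le
    have h3 := hy.regulator_mono hv.2.le
    have h4 : 0 ≤ κ * ((s : ℝ) - v) := mul_nonneg hκ.le (sub_nonneg.2 (by exact_mod_cast hv.2.le))
    have h5 : p * (regulator u s - regulator u v) < b := by
      have : regulator u s - regulator u v < b / p := by linarith
      rw [lt_div_iff₀ hp] at this
      linarith
    simp only [hVdef] at hVs ⊢
    simp only [hydef] at h3 hVs ⊢
    linarith
  obtain ⟨-, l, hl⟩ := hu.reflected_isCadlag s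
  have hl0 : 0 ≤ l := ge_of_tendsto' hl fun v => hu.reflected_nonneg v
  have hl' : l = 0 := by
    -- A positive left limit would freeze the feeder's regulator on some `[v, s]`; then `V` gains at
    -- least `κ * (s - v)` there, so `V v < 0`.
    by_contra hlne
    have hlpos : 0 < l := lt_of_le_of_ne hl0 (Ne.symm hlne)
    obtain ⟨v0, hv0, h⟩ := (mem_nhdsLT_iff_exists_Ioo_subset' hs).1 (hl.eventually_const_lt hlpos)
    obtain ⟨v, hv1, hv2⟩ := exists_between (show v0 < s from hv0)
    have hflat : regulator u v = regulator u s := hu.regulator_eq_of_pos hv2.le fun q hq => by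
      rcases hq.2.eq_or_lt with rfl | hq2
      · exact hus.ne'
      · exact (h ⟨hv1.trans hq.1, hq2⟩ : 0 < reflected u q).ne'
    have h2 := hA v s hv2.le
    have h3 := hy.regulator_mono hv2.le
    have h4 : 0 < κ * ((s : ℝ) - v) := mul_pos hκ (sub_pos.2 (by exact_mod_cast hv2))
    have h5 := hVnn v
    simp only [hVdef] at hVs h5
    simp only [hydef] at h3 hVs h5
    rw [hflat] at h5
    linarith
  have := hVlim.add ((hl' ▸ hl).const_mul p)
  simpa [hdec, funext hdec] using this

/-- If a fed station stays empty, then so does its feeder. -/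
theorem reflected_eq_zero_of_feed (hu : IsCadlag u) (hy : IsCadlag fun s => A s + p * u s)
    (hκ : 0 < κ) (hA : ∀ s t : ℝ≥0, s ≤ t → κ * (t - s) ≤ A t - A s) {a t : ℝ≥0}
    (h0 : ∀ s ∈ Ioo a t, A s - p * regulator u s + regulator (fun s => A s + p * u s) s = 0) :
    ∀ s ∈ Ioo a t, reflected (fun s => A s + p * u s) s = 0 := by
  set y : ℝ≥0 → ℝ := fun s => A s + p * u s with hydef
  intro v hv
  by_contra hne
  have hus : 0 < reflected u v := by
    refine lt_of_le_of_ne (hu.reflected_nonneg v) fun h => hne ?_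
    have := h0 v hv
    simp only [reflected, hydef] at h this ⊢
    have h2 : p * (u v + regulator u v) = 0 := by rw [← h]; simp
    linarith
  obtain ⟨b, hb, H⟩ := hu.reflected_isCadlag.exists_lt_near hus
  obtain ⟨v', h1, h2⟩ := exists_between (lt_min hb hv.2)
  -- While the feeder is nonempty its regulator is constant, so the fed content grows strictly and
  -- cannot vanish at both `v` and `v'`.
  have hflat : regulator u v = regulator u v' := hu.regulator_eq_of_pos h1.le fun q hq =>
    (H q hq.1.le (hq.2.trans_lt (h2.trans_le (min_le_left _ _)))).ne'
  have e1 := h0 v hv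
  have e2 := h0 v' ⟨hv.1.trans h1, h2.trans_le (min_le_right _ _)⟩
  have h2 := hA v v' h1.le
  have h3 := hy.regulator_mono h1.le
  have h4 : 0 < κ * ((v' : ℝ) - v) := mul_pos hκ (sub_pos.2 (by exact_mod_cast h1))
  rw [hflat] at e1
  linarith

end Feed

/-! ### Decoupling of the tree network. -/

section Tree

variable {Ω : Type*} [MeasurableSpace Ω] {n : ℕ} {μ : Measure Ω} {J : ℝ≥0 → Ω → Fin n → ℝ}
  {r : Fin n → ℝ} {P : Matrix (Fin n) (Fin n) ℝ}

theorem IsTreeFluidNetwork.isUnit_det (h : IsTreeFluidNetwork μ J r P) :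
    IsUnit (1 - Pᵀ).det := by
  have : (1 - Pᵀ).det = ∏ i, (1 - Pᵀ) i i := by
    refine Matrix.det_of_isLowerTriangular _ fun i j hij => ?_
    have hij' : i < j := hij
    simp [Matrix.sub_apply, Matrix.one_apply_ne hij'.ne, h.upper j i hij'.le]
  rw [this]
  simp [h.upper _ _ le_rfl]

/-- A station is either fed by no station or by exactly one station with a smaller label. -/
theorem IsTreeFluidNetwork.feeder (h : IsTreeFluidNetwork μ J r P) (j : Fin n) :
    (∀ x : Fin n → ℝ, ((1 - Pᵀ) *ᵥ x) j = x j) ∨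
    ∃ i < j, 0 < P i j ∧ ∀ x : Fin n → ℝ, ((1 - Pᵀ) *ᵥ x) j = x j - P i j * x i := by
  have hx : ∀ x : Fin n → ℝ, ((1 - Pᵀ) *ᵥ x) j = x j - ∑ i, P i j * x i := fun x => by
    rw [Matrix.sub_mulVec, Matrix.one_mulVec]
    simp [Matrix.mulVec, dotProduct]
  by_cases hj : ∃ i, 0 < P i j
  · obtain ⟨i, hi⟩ := hj
    refine Or.inr ⟨i, ?_, hi, fun x => ?_⟩
    · by_contra hc
      exact hi.ne' (h.upper i j (not_lt.1 hc))
    · rw [hx, Finset.sum_eq_single i (fun i' _ hne => ?_) (by simp)]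
      have : ¬ 0 < P i' j := fun h' => hne (h.feeder_unique i' i j h' hi)
      rw [le_antisymm (not_lt.1 this) (h.nonneg i' j), zero_mul]
  · left
    intro x
    push Not at hj
    rw [hx, Finset.sum_eq_zero fun i _ => ?_, sub_zero]
    rw [le_antisymm (hj i) (h.nonneg i j), zero_mul]

/-- The free aggregated content of station `j`, started at the aggregated content of `w`. -/
noncomputable def freeContent (r : Fin n → ℝ) (P : Matrix (Fin n) (Fin n) ℝ) (w : Fin n → ℝ)
    (J : ℝ≥0 → Fin n → ℝ) (j : Fin n) (t : ℝ≥0) : ℝ :=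
  ((1 - Pᵀ)⁻¹ *ᵥ w) j + netFree r P J t j

theorem IsTreeFluidNetwork.mulVec_inv (h : IsTreeFluidNetwork μ J r P) (x : Fin n → ℝ) :
    (1 - Pᵀ) *ᵥ ((1 - Pᵀ)⁻¹ *ᵥ x) = x := by
  rw [Matrix.mulVec_mulVec, Matrix.mul_nonsing_inv _ h.isUnit_det, Matrix.one_mulVec]

theorem IsTreeFluidNetwork.inv_mulVec (h : IsTreeFluidNetwork μ J r P) (x : Fin n → ℝ) :
    (1 - Pᵀ)⁻¹ *ᵥ ((1 - Pᵀ) *ᵥ x) = x := by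
  rw [Matrix.mulVec_mulVec, Matrix.nonsing_inv_mul _ h.isUnit_det, Matrix.one_mulVec]

theorem IsCadlag.netFree {J : ℝ≥0 → Fin n → ℝ} (hJ : IsCadlag J) : IsCadlag (netFree r P J) := by
  have h1 : IsCadlag fun t => (1 - Pᵀ)⁻¹ *ᵥ J t := hJ.comp_continuous (by fun_prop)
  have h2 : IsCadlag fun t : ℝ≥0 => -((t : ℝ) • r) := Continuous.isCadlag (by fun_prop)
  have := h1.add h2
  simp only [← sub_eq_add_neg] at this
  exact this

theorem IsCadlag.freeContent {J : ℝ≥0 → Fin n → ℝ} (hJ : IsCadlag J) (w : Fin n → ℝ) (j : Fin n) :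
    IsCadlag (freeContent r P w J j) :=
  (Continuous.isCadlag continuous_const).add (hJ.netFree.apply j)

/-- The free contents, disaggregated: initial content, external input and net drift. -/
theorem IsTreeFluidNetwork.feed_eq (h : IsTreeFluidNetwork μ J r P) (w : Fin n → ℝ)
    (Jp : ℝ≥0 → Fin n → ℝ) (t : ℝ≥0) (j : Fin n) :
    ((1 - Pᵀ) *ᵥ fun k => freeContent r P w Jp k t) j =
      w j + Jp t j - t * ((1 - Pᵀ) *ᵥ r) j := by
  have : (fun k => freeContent r P w Jp k t) = (1 - Pᵀ)⁻¹ *ᵥ w + ((1 - Pᵀ)⁻¹ *ᵥ Jp t - (t : ℝ) • r) := by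
    ext k; simp [freeContent, netFree]
  rw [this, Matrix.mulVec_add, Matrix.mulVec_sub, Matrix.mulVec_smul, h.mulVec_inv, h.mulVec_inv]
  simp; ring

variable {w : Fin n → ℝ} {Jp W L : ℝ≥0 → Fin n → ℝ}

/-- The inverse matrix cancels the reflection matrix, so each aggregated content is pushed by its
own component of `L` only. -/
theorem IsSkorokhodSolution.aggregate_eq_add (h : IsTreeFluidNetwork μ J r P)
    (hS : IsSkorokhodSolution (1 - Pᵀ) w (netInput r P Jp) W L) (t : ℝ≥0) (j : Fin n) :
    aggregate P W t j = freeContent r P w Jp j t + L t j := by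
  unfold aggregate
  rw [hS.eq t, netInput, Matrix.mulVec_add, Matrix.mulVec_add, Matrix.mulVec_sub,
    Matrix.mulVec_smul, h.inv_mulVec, h.inv_mulVec]
  simp [freeContent, netFree]

theorem IsSkorokhodSolution.mulVec_aggregate (h : IsTreeFluidNetwork μ J r P) (t : ℝ≥0) :
    (1 - Pᵀ) *ᵥ aggregate P W t = W t := h.mulVec_inv _

/-- In a tree fluid network, the regulators are those of the free aggregated contents. -/
theorem IsSkorokhodSolution.eq_regulator (h : IsTreeFluidNetwork μ J r P)
    (hrate : ∀ i j, 0 < P i j → r j / r i ≤ P i j)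
    (hmono : ∀ j : Fin n, 0 < (j : ℕ) → Monotone fun t => Jp t j) (hJp : IsCadlag Jp)
    (hJ0 : Jp 0 = 0) (hw : 0 ≤ w)
    (hS : IsSkorokhodSolution (1 - Pᵀ) w (netInput r P Jp) W L) (j : Fin n) (t : ℝ≥0) :
    L t j = regulator (freeContent r P w Jp j) t := by
  induction j using WellFoundedLT.induction generalizing t with
  | ind j ih =>
    obtain ⟨F, hF, hF0⟩ := hS.complementarity
    have hF0' : ∫⁻ t, ENNReal.ofReal (W t j) ∂(F j).measure = 0 :=
      (Finset.sum_eq_zero_iff.1 hF0) j (Finset.mem_univ j)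
    have hFz : F j 0 = 0 := by rw [hF, hS.L_zero]; rfl
    have hWeq : ∀ s, W s j = ((1 - Pᵀ) *ᵥ aggregate P W s) j := fun s => by
      rw [IsSkorokhodSolution.mulVec_aggregate h]
    have hyc : ∀ k, IsCadlag (freeContent r P w Jp k) := fun k => hJp.freeContent w k
    -- One-dimensional uniqueness identifies `L j` once the rest of `W j` is known as a path `Z`.
    have key : ∀ Z : ℝ≥0 → ℝ, IsCadlag Z → (∀ s, W s j = Z s + L s j) → L t j = regulator Z t := by
      intro Z hZ hWZ
      rw [← hF]
      refine eq_regulator_of_complementarity hZ (F j) hFz (fun s => ?_) ?_ hZ.measurable t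
      · rw [hF, ← hWZ]; exact hS.nonneg s j
      · simpa [hF, ← hWZ] using hF0'
    rcases h.feeder j with hx | ⟨i, hi, hp, hx⟩
    · refine key _ (hyc j) fun s => ?_
      rw [hWeq, hx, hS.aggregate_eq_add h]
    · set A : ℝ≥0 → ℝ := fun s => freeContent r P w Jp j s - P i j * freeContent r P w Jp i s
        with hA
      -- `A` is initial content, external input and the net rate with the feeder at full outflow;
      -- the rate condition makes this net rate nonnegative.
      have hAeq : ∀ s, A s = w j + Jp s j + s * (P i j * r i - r j) := fun s => by
        have := h.feed_eq w Jp s j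
        rw [hx, hx] at this
        simp only [hA, this]; ring
      have hκ : 0 ≤ P i j * r i - r j := by
        have := hrate i j hp
        rw [div_le_iff₀ (h.rate_pos i)] at this
        linarith
      have hAmono : Monotone A := fun a b hab => by
        rw [hAeq, hAeq]
        have h1 := hmono j (lt_of_le_of_lt (Nat.zero_le _) hi) hab
        have h2 : (a : ℝ) * (P i j * r i - r j) ≤ b * (P i j * r i - r j) :=
          mul_le_mul_of_nonneg_right (by exact_mod_cast hab) hκ
        linarith
      have hAc : IsCadlag A := by
        simpa [hA, sub_eq_add_neg] using
          (hyc j).add ((hyc i).comp_continuous (g := fun x => -(P i j * x)) (by fun_prop))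
      have hregc := (hyc i).regulator_isCadlag
      have e := regulator_feed hAmono (by rw [hAeq, hJ0]; simpa using hw j) hAc (hyc i) hp.le t
      have e2 : (fun s => A s + P i j * freeContent r P w Jp i s) = freeContent r P w Jp j := by
        ext s; simp [hA]
      rw [e2] at e
      rw [← e]
      refine key _ ?_ fun s => ?_
      · simpa [sub_eq_add_neg] using
          hAc.add (hregc.comp_continuous (g := fun x => -(P i j * x)) (by fun_prop))
      · rw [hWeq, hx, hS.aggregate_eq_add h, hS.aggregate_eq_add h, ih i hi]
        simp only [hA]; ring

theorem IsSkorokhodSolution.aggregate_eq_reflected (h : IsTreeFluidNetwork μ J r P)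
    (hrate : ∀ i j, 0 < P i j → r j / r i ≤ P i j)
    (hmono : ∀ j : Fin n, 0 < (j : ℕ) → Monotone fun t => Jp t j) (hJp : IsCadlag Jp)
    (hJ0 : Jp 0 = 0) (hw : 0 ≤ w)
    (hS : IsSkorokhodSolution (1 - Pᵀ) w (netInput r P Jp) W L) (j : Fin n) (t : ℝ≥0) :
    aggregate P W t j = reflected (freeContent r P w Jp j) t := by
  rw [hS.aggregate_eq_add h, hS.eq_regulator h hrate hmono hJp hJ0 hw, reflected]

end Tree

/-! ### Content and ages as functionals of the time-reversed path. -/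

/-- A dense sequence of times, starting at `0`. -/
noncomputable def gridTime : ℕ → ℝ≥0
  | 0 => 0
  | k + 1 => TopologicalSpace.denseSeq ℝ≥0 k

theorem exists_gridTime_between {a b : ℝ≥0} (h : a < b) : ∃ k, a < gridTime k ∧ gridTime k < b := by
  obtain ⟨_, ⟨k, rfl⟩, hk⟩ := (TopologicalSpace.denseRange_denseSeq ℝ≥0).exists_between h
  exact ⟨k + 1, hk⟩

theorem exists_sub_gridTime_between {s t u : ℝ≥0} (hst : s < t) (hsu : s < u) :
    ∃ k, s < t - gridTime k ∧ t - gridTime k < u ∧ gridTime k < t - s := by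
  obtain ⟨k, h1, h2⟩ := exists_gridTime_between
    (show t - min u t < t - s from
      (tsub_lt_tsub_iff_left_of_le (min_le_right _ _)).2 (lt_min hsu hst))
  refine ⟨k, lt_tsub_comm.1 h2, ?_, h2⟩
  exact ((tsub_lt_iff_tsub_lt (min_le_right _ _) (h2.le.trans tsub_le_self)).1 h1).trans_le
    (min_le_left _ _)

/-- The content functional of a time-reversed path. -/
noncomputable def contentFun (z : ℝ≥0 → ℝ) (c : ℝ) (t : ℝ≥0) : ℝ :=
  max (c + z t) (⨆ k, z (gridTime k))

open scoped Classical in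
/-- The busy-age functional of a time-reversed path. -/
noncomputable def busyFun (z : ℝ≥0 → ℝ) (c : ℝ) (t : ℝ≥0) : ℝ≥0 :=
  -- The age is the first time the reversed path reaches its final level. The fallback `t` encodes
  -- `sup ∅ = 0`; the padding value `0` is `z (gridTime 0)` for the paths in use.
  ⨅ k, if contentFun z c t ≤ ⨆ m, if gridTime m ≤ gridTime k then z (gridTime m) else 0
    then min (gridTime k) t else t

open scoped Classical in
/-- The idle-age functional of a time-reversed path. -/
noncomputable def idleFun (z : ℝ≥0 → ℝ) (c : ℝ) (t : ℝ≥0) : ℝ≥0∞ :=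
  -- For a reversed path, the two conditions at `m` say that the reflected path vanishes at `t -
  -- gridTime m`; a `k` failing the test contributes nothing.
  ⨆ k, if gridTime k ≤ t ∧ ∀ m, gridTime m < gridTime k → c + z t ≤ z (gridTime m) ∧
    ∀ l, gridTime m ≤ gridTime l → z (gridTime l) ≤ z (gridTime m) then (gridTime k : ℝ≥0∞) else 0

/-- The increments of `y` backwards from time `t`. -/
def reversed {E : Type*} [Sub E] (y : ℝ≥0 → E) (t s : ℝ≥0) : E := y t - y (t - s)

section Reversed

variable {y : ℝ≥0 → ℝ} {t : ℝ≥0}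

theorem IsCadlag.exists_grid_neg_gt (hy : IsCadlag y) {s u : ℝ≥0} {C : ℝ} (hst : s < t) (hsu : s < u)
    (h : C < - y s) : ∃ k, s < t - gridTime k ∧ t - gridTime k < u ∧ gridTime k < t - s ∧
      C < - y (t - gridTime k) := by
  obtain ⟨u', hu', H⟩ := hy.neg.exists_lt_near h
  obtain ⟨k, h1, h2, h3⟩ := exists_sub_gridTime_between hst (lt_min hsu hu')
  exact ⟨k, h1, h2.trans_le (min_le_left _ _), h3, H _ h1.le (h2.trans_le (min_le_right _ _))⟩

theorem IsCadlag.bddAbove_reversed (hy : IsCadlag y) :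
    BddAbove (range fun k => reversed y t (gridTime k)) := by
  obtain ⟨C, hC⟩ := hy.exists_bound t
  refine ⟨y t + C, ?_⟩
  rintro _ ⟨k, rfl⟩
  have := neg_le_of_abs_le (hC (t - gridTime k) tsub_le_self)
  simp only [reversed]
  linarith

/-- `reflected y t` is the maximum of `y t` and `sup_{s ≤ t} (y t - y s)`, and right continuity
reduces the supremum to grid times. -/
theorem IsCadlag.contentFun_reversed (hy : IsCadlag y) :
    contentFun (reversed y t) (y 0) t = reflected y t := by
  have hle : ∀ s ≤ t, y t - y s ≤ reflected y t := fun s hs => by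
    have := hy.neg_le_regulator hs
    simp only [reflected]; linarith
  have e0 : y 0 + reversed y t t = y t := by simp [reversed]
  unfold contentFun
  rw [e0]
  refine le_antisymm (max_le ?_ (ciSup_le fun k => hle _ tsub_le_self)) ?_
  · have := regulator_nonneg y t
    simp only [reflected]; linarith
  · have hk : ∀ k, - y (t - gridTime k) ≤ (⨆ k, reversed y t (gridTime k)) - y t := fun k => by
      have := le_ciSup (hy.bddAbove_reversed (t := t)) k
      simp only [reversed] at this ⊢
      linarith
    have : regulator y t ≤ max (y t) (⨆ k, reversed y t (gridTime k)) - y t := by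
      refine regulator_le (by linarith [le_max_left (y t) (⨆ k, reversed y t (gridTime k))])
        fun s hs => ?_
      have hmax := le_max_right (y t) (⨆ k, reversed y t (gridTime k))
      refine le_trans ?_ (sub_le_sub_right hmax _)
      -- The endpoint `t` cannot be approximated from the right inside `[0, t]`; it is a grid point
      -- because `gridTime 0 = 0`.
      rcases hs.eq_or_lt with rfl | hs
      · simpa [gridTime] using hk 0
      · by_contra hc
        obtain ⟨k, -, -, -, h⟩ := hy.exists_grid_neg_gt hs hs (not_le.1 hc)
        exact h.not_ge (hk k)
    simp only [reflected]; linarith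

/-- Zeros of the reflected path that are only left limits are accumulated by zeros. -/
def ZerosAccumulate (y : ℝ≥0 → ℝ) : Prop :=
  ∀ s > 0, Tendsto (reflected y) (𝓝[<] s) (𝓝 0) → reflected y s ≠ 0 →
    ∀ a < s, ∃ v ∈ Ioo a s, reflected y v = 0

/-- The last zero before `t` is where `-y` last reaches the level `regulator y t`, that is, where
the reversed path first reaches its maximum. A supremum over grid times also sees approaches by left
limits; `ZerosAccumulate` makes these harmless. -/
theorem IsCadlag.busyFun_reversed (hy : IsCadlag y) (hZ : ZerosAccumulate y) :
    busyFun (reversed y t) (y 0) t = t - sSup {s | s ≤ t ∧ reflected y s = 0} := by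
  classical
  set Z := {s | s ≤ t ∧ reflected y s = 0} with hZdef
  have hZb : BddAbove Z := ⟨t, fun s hs => hs.1⟩
  have hbd : ∀ k, BddAbove (range fun m => if gridTime m ≤ gridTime k then
      reversed y t (gridTime m) else 0) := fun k => by
    obtain ⟨C, hC⟩ := hy.bddAbove_reversed (t := t)
    refine ⟨max C 0, ?_⟩
    rintro _ ⟨m, rfl⟩
    dsimp only
    split_ifs
    · exact le_max_of_le_left (hC ⟨m, rfl⟩)
    · exact le_max_right _ _
  have hzero : ∀ k, gridTime k < t → contentFun (reversed y t) (y 0) t ≤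
      (⨆ m, if gridTime m ≤ gridTime k then reversed y t (gridTime m) else 0) →
      ∃ s ∈ Z, t - gridTime k ≤ s := by
    intro k hk hle
    by_contra hcon
    push Not at hcon
    rw [hy.contentFun_reversed] at hle
    have hpos : ∀ v ∈ Icc (t - gridTime k) t, reflected y v ≠ 0 := fun v hv h0 =>
      (hcon v ⟨hv.2, h0⟩).not_ge hv.1
    -- Without zeros on `[t - gridTime k, t]`, the path stays a distance `δ` above `-regulator y t`,
    -- so the partial supremum misses the content by `δ`.
    obtain ⟨δ, hδ, hgap⟩ := hy.exists_gap (a := t - gridTime k) (b := t) (m := - regulator y t)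
      (fun v hv => by
        have h1 := lt_of_le_of_ne (hy.reflected_nonneg v) (hpos v hv).symm
        have h2 := hy.regulator_mono hv.2
        simp only [reflected] at h1
        linarith)
      (fun v hv hlim => by
        have hv0 : 0 < v := lt_of_le_of_lt zero_le hv.1
        have hto : Tendsto (reflected y) (𝓝[<] v) (𝓝 0) := by
          have h1 : Tendsto (fun s => y s + regulator y t) (𝓝[<] v) (𝓝 0) := by
            simpa using hlim.add_const (regulator y t)
          refine tendsto_of_tendsto_of_tendsto_of_le_of_le' tendsto_const_nhds h1
            (Eventually.of_forall fun s => hy.reflected_nonneg s) ?_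
          filter_upwards [self_mem_nhdsWithin] with s hs
          have := hy.regulator_mono ((show s ≤ v from le_of_lt hs).trans hv.2)
          simp only [reflected]; linarith
        obtain ⟨q, hq, hq0⟩ := hZ v hv0 hto (hpos v ⟨hv.1.le, hv.2⟩) _ hv.1
        exact hpos q ⟨hq.1.le, hq.2.le.trans hv.2⟩ hq0)
    have : (⨆ m, if gridTime m ≤ gridTime k then reversed y t (gridTime m) else 0) ≤
        reflected y t - δ := by
      refine ciSup_le fun m => ?_
      split_ifs with hm
      · have := hgap (t - gridTime m) ⟨tsub_le_tsub_left hm t, tsub_le_self⟩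
        simp only [reversed, reflected]; linarith
      · have := hgap t ⟨tsub_le_self, le_rfl⟩
        simp only [reflected]; linarith
    linarith
  have hcond : ∀ s ∈ Z, ∀ k, t - s < gridTime k → contentFun (reversed y t) (y 0) t ≤
      (⨆ m, if gridTime m ≤ gridTime k then reversed y t (gridTime m) else 0) := by
    intro s hs k hk
    rw [hy.contentFun_reversed]
    by_contra hcon
    set S := (⨆ m, if gridTime m ≤ gridTime k then reversed y t (gridTime m) else 0) with hS
    have hm : ∀ m, gridTime m ≤ gridTime k → - y (t - gridTime m) ≤ S - y t := fun m hm => by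
      have := le_ciSup (hbd k) m
      simp only [if_pos hm] at this
      simp only [reversed] at this
      simp only [hS, reversed]
      linarith
    have hv : ∀ v, s ≤ v → v ≤ t → - y v ≤ S - y t := by
      intro v hsv hvt
      rcases hvt.eq_or_lt with rfl | hvt
      · simpa [gridTime] using hm 0 (by simp [gridTime])
      · by_contra hc
        obtain ⟨m, h1, h2, h3, h4⟩ := hy.exists_grid_neg_gt hvt hvt (not_le.1 hc)
        exact h4.not_ge (hm m (h3.le.trans ((tsub_le_tsub_left hsv t).trans hk.le)))
    have hs0 : regulator y s = - y s := by
      have := hs.2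
      simp only [reflected] at this
      linarith
    have hs1 := hv s le_rfl hs.1
    have : regulator y t ≤ S - y t := regulator_le ((regulator_nonneg y s).trans (hs0 ▸ hs1))
      fun v hvt => by
        rcases le_total v s with h | h
        · exact (hy.neg_le_regulator h).trans (hs0 ▸ hs1)
        · exact hv v h hvt
    simp only [reflected] at hcon
    linarith
  have hle : ∀ k, busyFun (reversed y t) (y 0) t ≤
      if contentFun (reversed y t) (y 0) t ≤
        ⨆ m, if gridTime m ≤ gridTime k then reversed y t (gridTime m) else 0
      then min (gridTime k) t else t := fun k => by
    unfold busyFun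
    exact (ciInf_le (OrderBot.bddBelow _) k).trans (le_of_eq (by congr))
  have hlet : busyFun (reversed y t) (y 0) t ≤ t := (hle 0).trans (by
    split_ifs
    · exact min_le_right _ _
    · exact le_rfl)
  refine le_antisymm (le_of_forall_gt_imp_ge_of_dense fun b hb => ?_) ?_
  · rcases lt_or_ge t b with htb | hbt
    · exact hlet.trans htb.le
    rcases Z.eq_empty_or_nonempty with hem | hne
    · rw [hem] at hb
      simp only [csSup_empty, bot_eq_zero, tsub_zero] at hb
      exact hlet.trans hb.le
    · have h1 : t - b < sSup Z := by
        have hst : sSup Z ≤ t := csSup_le hne fun s hs => hs.1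
        exact (tsub_lt_iff_tsub_lt hst hbt).1 hb
      obtain ⟨s, hs, h2⟩ := exists_lt_of_lt_csSup hne h1
      have h3 : t - s < b := (tsub_lt_iff_tsub_lt hbt hs.1).1 h2
      obtain ⟨k, h4, h5⟩ := exists_gridTime_between h3
      refine (hle k).trans ?_
      rw [if_pos (hcond s hs k h4)]
      exact (min_le_left _ _).trans h5.le
  · refine le_ciInf fun k => ?_
    split_ifs with h
    · refine le_min ?_ tsub_le_self
      rcases lt_or_ge (gridTime k) t with hk | hk
      · obtain ⟨s, hs, h1⟩ := hzero k hk (by convert h)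
        refine (tsub_le_tsub_left (le_csSup hZb hs) t).trans ?_
        exact tsub_le_iff_tsub_le.1 h1
      · exact tsub_le_self.trans hk
    · exact tsub_le_self

/-- Expresses a zero by comparisons of values of `y`, which can be tested on grid times. -/
theorem IsCadlag.reflected_eq_zero_iff (hy : IsCadlag y) {v : ℝ≥0} :
    reflected y v = 0 ↔ y v ≤ 0 ∧ ∀ s ≤ v, y v ≤ y s := by
  constructor
  · intro h
    have h1 : regulator y v = - y v := by simp only [reflected] at h; linarith
    refine ⟨by linarith [regulator_nonneg y v], fun s hs => ?_⟩
    have := hy.neg_le_regulator hs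
    linarith
  · rintro ⟨h1, h2⟩
    have : regulator y v = - y v := le_antisymm
      (regulator_le (by linarith) fun s hs => by linarith [h2 s hs]) (hy.neg_le_regulator le_rfl)
    simp [reflected, this]

theorem IsCadlag.idleFun_reversed (hy : IsCadlag y) :
    idleFun (reversed y t) (y 0) t =
      ((t - sSup {s | s ≤ t ∧ reflected y s ≠ 0} : ℝ≥0) : ℝ≥0∞) := by
  classical
  set N := {s | s ≤ t ∧ reflected y s ≠ 0} with hN
  have hNb : BddAbove N := ⟨t, fun s hs => hs.1⟩
  have hiff : ∀ m, (y 0 + reversed y t t ≤ reversed y t (gridTime m) ∧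
      ∀ l, gridTime m ≤ gridTime l → reversed y t (gridTime l) ≤ reversed y t (gridTime m)) ↔
      reflected y (t - gridTime m) = 0 := by
    intro m
    rw [hy.reflected_eq_zero_iff]
    simp only [reversed, tsub_self]
    constructor
    · rintro ⟨h1, h2⟩
      refine ⟨by linarith, fun s hs => ?_⟩
      rcases hs.eq_or_lt with rfl | hs
      · exact le_rfl
      · by_contra hc
        obtain ⟨l, h3, h4, h5, h6⟩ := hy.exists_grid_neg_gt (t := t) (hs.trans_le tsub_le_self) hs
          (C := - y (t - gridTime m)) (by linarith)
        have : gridTime m ≤ gridTime l := by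
          by_contra hc'
          exact h4.not_ge (tsub_le_tsub_left (not_le.1 hc').le t)
        linarith [h2 l this]
    · rintro ⟨h1, h2⟩
      exact ⟨by linarith, fun l hl => by linarith [h2 _ (tsub_le_tsub_left hl t)]⟩
  unfold idleFun
  simp only [hiff]
  refine le_antisymm (iSup_le fun k => ?_) (le_of_forall_lt_imp_le_of_dense fun a ha => ?_)
  · split_ifs with h
    · rw [ENNReal.coe_le_coe]
      have : sSup N ≤ t - gridTime k := csSup_le' fun s hs => by
        by_contra hc
        rw [not_le] at hc
        rcases hs.1.eq_or_lt with rfl | hst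
        · have h0 : gridTime 0 < gridTime k := by
            by_contra hc'
            have : gridTime k = 0 := by simpa [gridTime] using hc'
            rw [this] at hc; simp at hc
          exact hs.2 (by simpa [gridTime] using h.2 0 h0)
        · have hpos := lt_of_le_of_ne (hy.reflected_nonneg s) (Ne.symm hs.2)
          obtain ⟨u, hu, H⟩ := hy.reflected_isCadlag.exists_lt_near hpos
          obtain ⟨m, h1, h2, h3⟩ := exists_sub_gridTime_between hst hu
          refine (H _ h1.le h2).ne' (h.2 m (h3.trans ?_))
          exact (tsub_lt_iff_tsub_lt h.1 hst.le).1 hc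
      exact (le_tsub_iff_le_tsub h.1 (this.trans tsub_le_self)).2 this
    · exact zero_le
  · have hat : a ≠ ∞ := (ha.trans ENNReal.coe_lt_top).ne
    lift a to ℝ≥0 using hat
    rw [ENNReal.coe_lt_coe] at ha
    obtain ⟨k, h1, h2⟩ := exists_gridTime_between ha
    refine le_trans ?_ (le_iSup _ k)
    rw [if_pos]
    · exact ENNReal.coe_le_coe.2 h1.le
    · refine ⟨h2.le.trans tsub_le_self, fun m hm => ?_⟩
      by_contra hne
      have := le_csSup hNb (show t - gridTime m ∈ N from ⟨tsub_le_self, hne⟩)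
      have h4 : gridTime m < t - sSup N := hm.trans h2
      exact (lt_tsub_comm.1 h4).not_ge this

end Reversed

/-! ### Convergence of the functionals along the stopped path. -/

section Limit

variable {x : ℝ≥0 → ℝ}

theorem IsCadlag.bddAbove_range (hx : IsCadlag x) (hlim : Tendsto x atTop atBot) :
    BddAbove (range x) := by
  obtain ⟨T, hT⟩ := eventually_atTop.1 (hlim.eventually_le_atBot 0)
  obtain ⟨C, hC⟩ := hx.exists_bound T
  refine ⟨max C 0, ?_⟩
  rintro _ ⟨s, rfl⟩
  rcases le_total s T with h | h
  · exact le_max_of_le_left ((le_abs_self _).trans (hC s h))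
  · exact le_max_of_le_right (hT s h)

theorem IsCadlag.exists_grid_gt (hx : IsCadlag x) {s u : ℝ≥0} {a : ℝ} (hsu : s < u) (h : a < x s) :
    ∃ k, s < gridTime k ∧ gridTime k < u ∧ a < x (gridTime k) := by
  obtain ⟨u', hu', H⟩ := hx.exists_lt_near h
  obtain ⟨k, h1, h2⟩ := exists_gridTime_between (lt_min hsu hu')
  exact ⟨k, h1, h2.trans_le (min_le_left _ _), H _ h1.le (h2.trans_le (min_le_right _ _))⟩

variable (hx : IsCadlag x) (hlim : Tendsto x atTop atBot) (hx0 : x 0 = 0) (c : ℝ)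
include hx hlim

theorem IsCadlag.bddAbove_stopped (t : ℝ≥0) :
    BddAbove (range fun k => x (min (gridTime k) t)) := by
  obtain ⟨C, hC⟩ := hx.bddAbove_range hlim
  exact ⟨C, by rintro _ ⟨k, rfl⟩; exact hC ⟨_, rfl⟩⟩

theorem IsCadlag.exists_grid_contentFun_gt {a : ℝ} (ha : a < ⨆ s, x s) :
    ∃ k, ∀ t ≥ gridTime k, a < contentFun (fun s => x (min s t)) c t := by
  obtain ⟨s, hs⟩ := exists_lt_of_lt_ciSup ha
  obtain ⟨k, -, -, hk⟩ := hx.exists_grid_gt (lt_add_one s) hs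
  refine ⟨k, fun t ht => hk.trans_le (le_max_of_le_right ?_)⟩
  have := le_ciSup (hx.bddAbove_stopped hlim t) k
  simpa [min_eq_left ht] using this

include hx0 in
-- The initial condition enters only through `c + x t`, which drifts below `x 0 = 0`.
theorem IsCadlag.eventually_contentFun_le :
    ∀ᶠ t in atTop, contentFun (fun s => x (min s t)) c t ≤ ⨆ s, x s := by
  have hb := hx.bddAbove_range hlim
  filter_upwards [hlim.eventually_le_atBot (-c)] with t ht
  refine max_le ?_ (ciSup_le fun k => le_ciSup hb _)
  have := le_ciSup hb 0
  simp only [min_self]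
  linarith

include hx0 in
theorem IsCadlag.tendsto_contentFun :
    Tendsto (fun t => contentFun (fun s => x (min s t)) c t) atTop (𝓝 (⨆ s, x s)) := by
  refine tendsto_order.2 ⟨fun a ha => ?_, fun b hb => ?_⟩
  · obtain ⟨k, hk⟩ := hx.exists_grid_contentFun_gt hlim c ha
    exact (eventually_ge_atTop (gridTime k)).mono hk
  · exact (hx.eventually_contentFun_le hlim hx0 c).mono fun t ht => ht.trans_lt hb

/-- If the supremum is not approached on `[0, b]`, then the path stays away from it there. -/
theorem IsCadlag.exists_gap_iSup {b : ℝ≥0} (hb : ∀ t ≤ b, ¬ (x t = (⨆ s, x s) ∨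
    (0 < t ∧ Tendsto x (𝓝[<] t) (𝓝 (⨆ s, x s))))) :
    ∃ δ > 0, ∀ s ≤ b, x s ≤ (⨆ s, x s) - δ := by
  have hbd := hx.bddAbove_range hlim
  obtain ⟨δ, hδ, H⟩ := hx.neg.exists_gap (a := 0) (b := b) (m := - ⨆ s, x s)
    (fun v hv => by
      have h1 := le_ciSup hbd v
      have h2 : x v ≠ ⨆ s, x s := fun h => hb v hv.2 (Or.inl h)
      have := lt_of_le_of_ne h1 h2
      linarith)
    (fun v hv h => hb v hv.2 (Or.inr ⟨hv.1, by simpa using h.neg⟩))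
  exact ⟨δ, hδ, fun s hs => by linarith [H s ⟨zero_le, hs⟩]⟩

include hx0 in
-- Otherwise the path stays away from its supremum on a compact interval, and after it lies below
-- `-1`, while the supremum is at least `x 0 = 0`.
theorem IsCadlag.exists_maxEpoch : {t | x t = (⨆ s, x s) ∨
    (0 < t ∧ Tendsto x (𝓝[<] t) (𝓝 (⨆ s, x s)))}.Nonempty := by
  by_contra hcon
  rw [not_nonempty_iff_eq_empty, eq_empty_iff_forall_notMem] at hcon
  obtain ⟨T, hT⟩ := eventually_atTop.1 (hlim.eventually_le_atBot (-1))
  obtain ⟨δ, hδ, H⟩ := hx.exists_gap_iSup hlim (b := T) fun t _ => hcon t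
  have h0 : 0 ≤ ⨆ s, x s := hx0 ▸ le_ciSup (hx.bddAbove_range hlim) 0
  have : (⨆ s, x s) ≤ max ((⨆ s, x s) - δ) (-1) := by
    refine ciSup_le fun s => ?_
    rcases le_total s T with h | h
    · exact le_max_of_le_left (H s h)
    · exact le_max_of_le_right (hT s h)
  rcases le_max_iff.1 this with h | h <;> linarith

include hx0 in
-- Before the first approach the path stays `δ` below the supremum, which the content eventually
-- beats. Just after it, grid values come arbitrarily close to the supremum, which eventually bounds
-- the content.
theorem IsCadlag.tendsto_busyFun :
    Tendsto (fun t => busyFun (fun s => x (min s t)) c t) atTop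
      (𝓝 (sInf {t | x t = (⨆ s, x s) ∨ (0 < t ∧ Tendsto x (𝓝[<] t) (𝓝 (⨆ s, x s)))})) := by
  classical
  set S := ⨆ s, x s with hS
  set A := {t | x t = S ∨ (0 < t ∧ Tendsto x (𝓝[<] t) (𝓝 S))} with hA
  have hbd := hx.bddAbove_range hlim
  have hbd' : ∀ t k, BddAbove (range fun m => if gridTime m ≤ gridTime k then
      x (min (gridTime m) t) else 0) := fun t k => by
    obtain ⟨C, hC⟩ := hbd
    refine ⟨max C 0, ?_⟩
    rintro _ ⟨m, rfl⟩
    dsimp only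
    split_ifs
    · exact le_max_of_le_left (hC ⟨_, rfl⟩)
    · exact le_max_right _ _
  refine tendsto_order.2 ⟨fun a ha => ?_, fun b hb => ?_⟩
  · obtain ⟨b, hab, hbA⟩ := exists_between ha
    obtain ⟨δ, hδ, H⟩ := hx.exists_gap_iSup hlim (b := b) fun t ht hc =>
      (csInf_le (OrderBot.bddBelow A) (show t ∈ A from hc)).not_gt (ht.trans_lt hbA)
    obtain ⟨k0, hk0⟩ := hx.exists_grid_contentFun_gt hlim c (a := S - δ) (by linarith)
    filter_upwards [eventually_ge_atTop (gridTime k0), eventually_ge_atTop b] with t h1 h2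
    refine hab.trans_le (le_ciInf fun k => ?_)
    split_ifs with h
    · refine le_min ?_ h2
      by_contra hc
      refine (h.trans_lt' (hk0 t h1)).not_ge (ciSup_le fun m => ?_)
      split_ifs with hm
      · exact H _ ((min_le_left _ _).trans (hm.trans (not_le.1 hc).le))
      · exact hx0 ▸ H 0 zero_le
    · exact h2
  · obtain ⟨t0, ht0, h0b⟩ := exists_lt_of_csInf_lt (hx.exists_maxEpoch hlim hx0) hb
    obtain ⟨k, hk1, hk2⟩ := exists_gridTime_between h0b
    filter_upwards [eventually_ge_atTop (gridTime k), hx.eventually_contentFun_le hlim hx0 c]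
      with t h1 h2
    have hcond : S ≤ ⨆ m, if gridTime m ≤ gridTime k then x (min (gridTime m) t) else 0 := by
      refine le_of_forall_lt_imp_le_of_dense fun a ha => ?_
      have hm : ∃ m, gridTime m < gridTime k ∧ a < x (gridTime m) := by
        rcases ht0 with h | ⟨hpos, h⟩
        · obtain ⟨m, -, h4, h5⟩ := hx.exists_grid_gt hk1 (ha.trans_eq h.symm)
          exact ⟨m, h4, h5⟩
        · obtain ⟨v, hv, H⟩ := (mem_nhdsLT_iff_exists_Ioo_subset' hpos).1
            (h.eventually_const_lt ha)
          obtain ⟨m, h4, h5⟩ := exists_gridTime_between (show v < t0 from hv)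
          exact ⟨m, h5.trans hk1, H ⟨h4, h5⟩⟩
      obtain ⟨m, h4, h5⟩ := hm
      have := le_ciSup (hbd' t k) m
      rw [if_pos h4.le, min_eq_left (h4.le.trans h1)] at this
      exact h5.le.trans this
    refine lt_of_le_of_lt ?_ hk2
    unfold busyFun
    refine (ciInf_le (OrderBot.bddBelow _) k).trans ?_
    rw [if_pos (h2.trans (by convert hcond))]
    exact min_le_left _ _

/-- Before the infimum every value dominates all later ones, and the comparison with `c + x t` holds
for large `t` by the drift. A time in the set has a larger later value; right continuity moves both
to grid times, and this pair blocks all larger ages. -/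
theorem IsCadlag.tendsto_idleFun :
    Tendsto (fun t => idleFun (fun s => x (min s t)) c t) atTop
      (𝓝 (sInf ((fun t : ℝ≥0 => (t : ℝ≥0∞)) '' {t : ℝ≥0 | (⨆ s : Ici t, x s) ≠ x t}))) := by
  classical
  set A := {t : ℝ≥0 | (⨆ s : Ici t, x s) ≠ x t} with hA
  have hbd : ∀ t : ℝ≥0, BddAbove (range fun s : Ici t => x (s : ℝ≥0)) := fun t => by
    obtain ⟨C, hC⟩ := hx.bddAbove_range hlim
    exact ⟨C, by rintro _ ⟨k, rfl⟩; exact hC ⟨_, rfl⟩⟩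
  refine tendsto_order.2 ⟨fun a ha => ?_, fun b hb => ?_⟩
  · obtain ⟨a', h1, h2⟩ := ENNReal.lt_iff_exists_nnreal_btwn.1 ha
    obtain ⟨b, h3, h4⟩ := ENNReal.lt_iff_exists_nnreal_btwn.1 h2
    obtain ⟨k, h5, h6⟩ := exists_gridTime_between (ENNReal.coe_lt_coe.1 h3)
    obtain ⟨K, hK⟩ := hx.exists_bound (gridTime k)
    filter_upwards [eventually_ge_atTop (gridTime k), hlim.eventually_le_atBot (-K - c)] with t h7 h8
    refine (h1.trans (ENNReal.coe_lt_coe.2 h5)).trans_le ?_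
    unfold idleFun
    refine le_trans ?_ (le_iSup _ k)
    rw [if_pos]
    refine ⟨h7, fun m hm => ⟨?_, fun l hl => ?_⟩⟩
    · have := neg_le_of_abs_le (hK _ hm.le)
      dsimp only
      rw [min_self, min_eq_left (hm.le.trans h7)]
      linarith
    · have hmA : gridTime m ∉ A := fun hc => by
        have := sInf_le (mem_image_of_mem (fun t : ℝ≥0 => (t : ℝ≥0∞)) hc)
        exact (this.trans_lt (ENNReal.coe_lt_coe.2 (hm.trans h6))).not_ge h4.le
      have hmA' : (⨆ s : Ici (gridTime m), x s) = x (gridTime m) := by simpa [hA] using hmA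
      dsimp only
      rw [min_eq_left (hm.le.trans h7), ← hmA']
      exact le_ciSup (hbd _) ⟨min (gridTime l) t, le_min hl (hm.le.trans h7)⟩
  · obtain ⟨_, ⟨t0, ht0, rfl⟩, h0b⟩ := sInf_lt_iff.1 hb
    have hlt : x t0 < ⨆ s : Ici t0, x s :=
      lt_of_le_of_ne (le_ciSup (hbd t0) ⟨t0, self_mem_Ici⟩) (Ne.symm ht0)
    have hne : Nonempty (Ici t0) := ⟨⟨t0, self_mem_Ici⟩⟩
    obtain ⟨⟨v, hv⟩, hv'⟩ := exists_lt_of_lt_ciSup hlt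
    have hv0 : t0 < v := lt_of_le_of_ne hv (by rintro rfl; exact lt_irrefl _ hv')
    obtain ⟨e, he1, he2⟩ := exists_between hv'
    obtain ⟨b', hb1, hb2⟩ := ENNReal.lt_iff_exists_nnreal_btwn.1 h0b
    obtain ⟨m, hm1, hm2, hm3⟩ := hx.neg.exists_grid_gt (s := t0) (a := -e)
      (lt_min (ENNReal.coe_lt_coe.1 hb1) hv0) (by linarith)
    obtain ⟨l, hl1, -, hl3⟩ := hx.exists_grid_gt (lt_add_one v) he2
    have hml : gridTime m ≤ gridTime l := (hm2.le.trans (min_le_right _ _)).trans hl1.le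
    filter_upwards [eventually_ge_atTop (gridTime l)] with t ht
    refine lt_of_le_of_lt ?_ ((ENNReal.coe_lt_coe.2 (hm2.trans_le (min_le_left _ _))).trans hb2)
    refine iSup_le fun k => ?_
    split_ifs with h
    · rw [ENNReal.coe_le_coe]
      by_contra hc
      have := (h.2 m (not_le.1 hc)).2 l hml
      dsimp only at this
      rw [min_eq_left ht, min_eq_left (hml.trans ht)] at this
      linarith
    · exact zero_le

end Limit

/-! ### Laws of processes with independent increments: reversal and shift. -/

/-- A finite set of times is listed by a monotone sequence starting at `0`. -/
theorem exists_monotone_seq_through (I : Finset ℝ≥0) :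
    ∃ τ : ℕ → ℝ≥0, Monotone τ ∧ τ 0 = 0 ∧ ∀ t ∈ I, ∃ k, τ k = t := by
  set I' := insert 0 I
  let c : ℝ≥0 → ℕ := fun t => (I'.filter (· < t)).card
  refine ⟨fun k => (I'.filter (fun t => c t ≤ k)).sup id, fun k l hkl => ?_, ?_, fun t ht => ?_⟩
  · refine Finset.sup_mono fun t ht => ?_
    rw [Finset.mem_filter] at ht ⊢
    exact ⟨ht.1, ht.2.trans hkl⟩
  · refine le_antisymm (Finset.sup_le fun t ht => ?_) zero_le
    rw [Finset.mem_filter, Nat.le_zero, Finset.card_eq_zero, Finset.filter_eq_empty_iff] at ht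
    simpa using ht.2 (Finset.mem_insert_self 0 I)
  · have htI : t ∈ I' := Finset.mem_insert_of_mem ht
    refine ⟨c t, le_antisymm (Finset.sup_le fun s hs => ?_) (Finset.le_sup (f := id) (by simp [htI]))⟩
    rw [Finset.mem_filter] at hs
    by_contra hc
    have hts : t < s := not_le.1 hc
    refine hs.2.not_gt (Finset.card_lt_card ?_)
    rw [Finset.ssubset_iff_of_subset fun v hv => by
      rw [Finset.mem_filter] at hv ⊢; exact ⟨hv.1, hv.2.trans hts⟩]
    exact ⟨t, by simp [htI, hts], by simp⟩

section Law

variable {Ω : Type*} [MeasurableSpace Ω] {n : ℕ} {μ : Measure Ω}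

theorem HasIndepIncrements.reversed {X : ℝ≥0 → Ω → Fin n → ℝ} (hX : HasIndepIncrements X μ)
    (t : ℝ≥0) : HasIndepIncrements (fun s ω => X t ω - X (t - s) ω) μ := by
  intro m σ hσ
  have h1 := hX m (fun i => t - σ (Fin.rev i)) fun i j hij =>
    tsub_le_tsub_left (hσ (Fin.rev_le_rev.2 hij)) t
  have h2 := h1.precomp (g := Fin.rev) Fin.rev_injective
  convert h2 using 3 with i ω
  simp [Fin.rev_succ, Fin.rev_castSucc]

theorem HasIndepIncrements.comp_monotone {X : ℝ≥0 → Ω → Fin n → ℝ} (hX : HasIndepIncrements X μ)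
    {f : ℝ≥0 → ℝ≥0} (hf : Monotone f) : HasIndepIncrements (fun s => X (f s)) μ :=
  fun m σ hσ => hX m (f ∘ σ) (hf.comp hσ)

theorem HasIndepIncrements.sub_eval {X : ℝ≥0 → Ω → Fin n → ℝ} (hX : HasIndepIncrements X μ)
    (q : ℝ≥0) : HasIndepIncrements (fun s ω => X s ω - X q ω) μ := fun m σ hσ => by
  simpa using hX m σ hσ

variable {X : ℝ≥0 → Ω → Fin n → ℝ} (hX : IsLevyProcess X μ)
include hX

theorem IsLevyProcess.identDistrib_sub {s t : ℝ≥0} (h : s ≤ t) :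
    IdentDistrib (fun ω => X t ω - X s ω) (X (t - s)) μ μ := by
  have := hX.stationary s (t - s)
  rwa [add_tsub_cancel_of_le h] at this

end Law

section Law

variable {Ω : Type*} [MeasurableSpace Ω] {n : ℕ} {μ : Measure Ω} [IsProbabilityMeasure μ]

/-- The law of a process with independent increments is determined by the laws of the
increments. -/
theorem HasIndepIncrements.map_eq {Y Z : ℝ≥0 → Ω → Fin n → ℝ} (hY : HasIndepIncrements Y μ)
    (hZ : HasIndepIncrements Z μ) (hYm : ∀ t, Measurable (Y t)) (hZm : ∀ t, Measurable (Z t))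
    (hY0 : ∀ᵐ ω ∂μ, Y 0 ω = 0) (hZ0 : ∀ᵐ ω ∂μ, Z 0 ω = 0)
    (h : ∀ s t, s ≤ t → IdentDistrib (fun ω => Y t ω - Y s ω) (fun ω => Z t ω - Z s ω) μ μ) :
    μ.map (fun ω t => Y t ω) = μ.map (fun ω t => Z t ω) := by
  rw [map_eq_iff_forall_finset_map_restrict_eq (measurable_pi_lambda _ hYm).aemeasurable
    (measurable_pi_lambda _ hZm).aemeasurable]
  intro I
  obtain ⟨τ, hτ, hτ0, hI⟩ := exists_monotone_seq_through I
  choose! K hK using hI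
  -- Partial sums recover the values from the independent increments, since the process starts at
  -- `0`.
  let Φ : (ℕ → Fin n → ℝ) → (I → Fin n → ℝ) := fun v t => ∑ j ∈ Finset.range (K t), v j
  have hΦ : Measurable Φ := by fun_prop
  have key : ∀ X : ℝ≥0 → Ω → Fin n → ℝ, HasIndepIncrements X μ → (∀ t, Measurable (X t)) →
      (∀ᵐ ω ∂μ, X 0 ω = 0) → μ.map (fun ω => I.restrict (fun t => X t ω)) =
        (Measure.infinitePi fun i => μ.map (fun ω => X (τ (i + 1)) ω - X (τ i) ω)).map Φ := by
    intro X hX hXm hX0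
    have hm : ∀ i, Measurable (fun ω => X (τ (i + 1)) ω - X (τ i) ω) := fun i =>
      (hXm _).sub (hXm _)
    rw [← (iIndepFun_iff_map_fun_eq_infinitePi_map hm).1 (hX.nat hτ),
      Measure.map_map hΦ (measurable_pi_lambda _ hm)]
    refine Measure.map_congr ?_
    filter_upwards [hX0] with ω hω
    ext t i
    simp only [Finset.restrict, Function.comp, Φ]
    rw [Finset.sum_range_sub (fun k => X (τ k) ω), hK t t.2, hτ0, hω, sub_zero]
  rw [key Y hY hYm hY0, key Z hZ hZm hZ0]
  congr 2
  ext1 i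
  exact (h _ _ (hτ (Nat.le_succ i))).map_eq

variable {X : ℝ≥0 → Ω → Fin n → ℝ} (hX : IsLevyProcess X μ)
include hX

/-- Time reversal: on `[0, t]`, the increments backwards from `t` have the law of the process. -/
theorem IsLevyProcess.map_reversed (t : ℝ≥0) :
    μ.map (fun ω s => X t ω - X (t - s) ω) = μ.map (fun ω s => X (min s t) ω) := by
  refine HasIndepIncrements.map_eq (HasIndepIncrements.reversed hX.indep t)
    (HasIndepIncrements.comp_monotone hX.indep (f := fun s => min s t)
      fun a b hab => min_le_min_right t hab)
    (fun s => (hX.measurable _).sub (hX.measurable _)) (fun s => hX.measurable _)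
    (by simp) (by simpa using hX.zero) fun a b hab => ?_
  have e1 : (fun ω => X t ω - X (t - b) ω - (X t ω - X (t - a) ω)) =
      fun ω => X (t - a) ω - X (t - b) ω := by ext; simp
  rw [e1]
  have h2 := hX.identDistrib_sub (min_le_min_right t hab)
  have h1 := hX.identDistrib_sub (tsub_le_tsub_left hab t)
  have e2 : t - a - (t - b) = min b t - min a t := by
    rcases le_total b t with hb | hb
    · rw [min_eq_left hb, min_eq_left (hab.trans hb)]
      rw [tsub_tsub_tsub_cancel_left hb]
    · rw [min_eq_right hb, tsub_eq_zero_of_le hb, tsub_zero]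
      rcases le_total a t with ha | ha
      · rw [min_eq_left ha]
      · rw [min_eq_right ha, tsub_eq_zero_of_le ha, tsub_self]
  rw [e2] at h1
  exact h1.trans h2.symm

theorem IsLevyProcess.map_shift (q : ℝ≥0) :
    μ.map (fun ω h => X (q + h) ω - X q ω) = μ.map (fun ω s => X s ω) := by
  refine HasIndepIncrements.map_eq (HasIndepIncrements.comp_monotone
      (HasIndepIncrements.sub_eval hX.indep q) (f := fun s => q + s)
      fun a b hab => by dsimp only; gcongr) hX.indep
    (fun s => (hX.measurable _).sub (hX.measurable _)) (fun s => hX.measurable _)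
    (by simp) hX.zero fun a b hab => ?_
  have e1 : (fun ω => X (q + b) ω - X q ω - (X (q + a) ω - X q ω)) =
      fun ω => X (q + b) ω - X (q + a) ω := by ext; simp
  rw [e1]
  have h1 := hX.identDistrib_sub (add_le_add_right hab q)
  rw [add_tsub_add_eq_tsub_left] at h1
  exact h1.trans (hX.identDistrib_sub hab).symm

/-- The increments after time `q` are independent of the path up to time `q`. -/
theorem IsLevyProcess.indep_past_future (q : ℝ≥0) :
    IndepFun (fun ω (v : Iic q) => X v ω) (fun ω (h : ℝ≥0) => X (q + h) ω - X q ω) μ := by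
  refine IndepFun.process_indepFun_process (X := fun (v : Iic q) ω => X v ω)
    (Y := fun h ω => X (q + h) ω - X q ω) (fun v => hX.measurable _)
    (fun h => (hX.measurable _).sub (hX.measurable _)) fun I H => ?_
  classical
  -- One monotone list contains `q` and all times involved; increments before index `k0` give the
  -- past, those from `k0` on give the future.
  obtain ⟨τ, hτ, hτ0, hA⟩ := exists_monotone_seq_through
    (insert q (I.image (fun v : Iic q => (v : ℝ≥0)) ∪ H.image (fun h => q + h)))
  obtain ⟨k0, hk0⟩ := hA q (by simp)
  have hI : ∀ v : I, ∃ k ≤ k0, τ k = v := fun v => by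
    obtain ⟨k, hk⟩ := hA v (Finset.mem_insert_of_mem (Finset.mem_union_left _
      (Finset.mem_image_of_mem _ v.2)))
    rcases le_total k k0 with h | h
    · exact ⟨k, h, hk⟩
    · exact ⟨k0, le_rfl, le_antisymm (hk ▸ hτ h) (hk0.symm ▸ v.1.2)⟩
  have hH : ∀ h : H, ∃ k ≥ k0, τ k = q + h := fun h => by
    obtain ⟨k, hk⟩ := hA (q + h) (Finset.mem_insert_of_mem (Finset.mem_union_right _
      (Finset.mem_image_of_mem _ h.2)))
    rcases le_total k0 k with h' | h'
    · exact ⟨k, h', hk⟩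
    · exact ⟨k0, le_rfl, le_antisymm (hk0.symm ▸ le_self_add) (hk ▸ hτ h')⟩
  choose K hK hK' using hI
  choose M hM hM' using hH
  set inc : ℕ → Ω → Fin n → ℝ := fun i ω => X (τ (i + 1)) ω - X (τ i) ω with hinc
  have hind : iIndepFun inc μ := hX.indep.nat hτ
  obtain ⟨N, hN⟩ : ∃ N, ∀ h, M h ≤ N := ⟨Finset.univ.sup M, fun h => Finset.le_sup (Finset.mem_univ h)⟩
  have h1 := hind.indepFun_finset (Finset.range k0) (Finset.Ico k0 N)
    (Finset.disjoint_left.2 fun a ha hb => by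
      rw [Finset.mem_range] at ha
      rw [Finset.mem_Ico] at hb
      omega)
    (fun i => (hX.measurable _).sub (hX.measurable _))
  let Φ : (Finset.range k0 → Fin n → ℝ) → (I → Fin n → ℝ) := fun a v =>
    ∑ j : Finset.range k0, if (j : ℕ) < K v then a j else 0
  let Ψ : (Finset.Ico k0 N → Fin n → ℝ) → (H → Fin n → ℝ) := fun a h =>
    ∑ j : Finset.Ico k0 N, if (j : ℕ) < M h then a j else 0
  have hΦ : Measurable Φ := by
    refine measurable_pi_lambda _ fun v => Finset.measurable_sum _ fun j _ => ?_
    split_ifs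
    · exact measurable_pi_apply j
    · exact measurable_const
  have hΨ : Measurable Ψ := by
    refine measurable_pi_lambda _ fun v => Finset.measurable_sum _ fun j _ => ?_
    split_ifs
    · exact measurable_pi_apply j
    · exact measurable_const
  refine (h1.comp hΦ hΨ).congr ?_ (ae_of_all _ fun ω => ?_)
  · filter_upwards [hX.zero] with ω hω
    funext v
    simp only [Function.comp, Φ]
    rw [Finset.sum_coe_sort (Finset.range k0) (fun j => if j < K v then inc j ω else 0),
      ← Finset.sum_filter]
    have : (Finset.range k0).filter (· < K v) = Finset.range (K v) := by
      ext j; have := hK v; simp; omega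
    rw [this, Finset.sum_range_sub (fun k => X (τ k) ω), hK', hτ0, hω, sub_zero]
  · funext h
    simp only [Function.comp, Ψ]
    rw [Finset.sum_coe_sort (Finset.Ico k0 N) (fun j => if j < M h then inc j ω else 0),
      ← Finset.sum_filter]
    have : (Finset.Ico k0 N).filter (· < M h) = Finset.Ico k0 (M h) := by
      ext j; have := hN h; simp; omega
    rw [this, Finset.sum_Ico_sub (fun k => X (τ k) ω) (hM h), hM', hk0]

end Law

section Free

variable {Ω : Type*} [MeasurableSpace Ω] {n : ℕ} {μ : Measure Ω} {J : ℝ≥0 → Ω → Fin n → ℝ}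

theorem IsLevyProcess.netFree (hJ : IsLevyProcess J μ) (r : Fin n → ℝ)
    (P : Matrix (Fin n) (Fin n) ℝ) :
    IsLevyProcess (fun t ω => netFree r P (fun s => J s ω) t) μ := by
  let g : ℝ → (Fin n → ℝ) → (Fin n → ℝ) := fun a x => (1 - Pᵀ)⁻¹ *ᵥ x - a • r
  have hgc : ∀ a, Continuous (g a) := fun a => by fun_prop
  have hg : ∀ a, Measurable (g a) := fun a => (hgc a).measurable
  have hsub : ∀ s t ω, _root_.netFree r P (fun s => J s ω) t - _root_.netFree r P (fun s => J s ω) s =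
      g (t - s) (J t ω - J s ω) := fun s t ω => by
    simp only [g, _root_.netFree, Matrix.mulVec_sub, sub_smul]
    abel
  refine ⟨fun t => (hg t).comp (hJ.measurable t), ?_, fun m σ hσ => ?_, fun s t => ?_, ?_⟩
  · filter_upwards [hJ.zero] with ω hω
    simp [_root_.netFree, hω]
  · simp only [hsub]
    exact (hJ.indep m σ hσ).comp (fun i => g (σ i.succ - σ i.castSucc)) fun i => hg _
  · simp only [hsub]
    have := (hJ.stationary s t).comp (hg t)
    convert this using 1
    · ext ω
      simp
    · rfl
  · filter_upwards [hJ.cadlag] with ω hω using hω.netFree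

end Free

/-! ### Past σ-algebras and the Markov property at discrete first times. -/

section PastSigma

variable {Ω : Type*} {n : ℕ}

/-- The event that `s` is the first time in `T` at which `A` occurs. -/
def firstIn (T : Finset ℝ≥0) (A : ℝ≥0 → Set Ω) (s : ℝ≥0) : Set Ω :=
  A s \ ⋃ v ∈ T.filter (· < s), A v

theorem pairwiseDisjoint_firstIn (T : Finset ℝ≥0) (A : ℝ≥0 → Set Ω) :
    (T : Set ℝ≥0).PairwiseDisjoint (firstIn T A) := by
  have : ∀ s ∈ T, ∀ t, s < t → Disjoint (firstIn T A s) (firstIn T A t) := fun s hs t hst =>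
    Set.disjoint_left.2 fun ω h1 h2 => h2.2 (mem_biUnion (by simpa using ⟨hs, hst⟩) h1.1)
  intro s hs t ht hst
  rcases lt_or_gt_of_ne hst with h | h
  · exact this s hs t h
  · exact (this t ht s h).symm

theorem iUnion_firstIn (T : Finset ℝ≥0) (A : ℝ≥0 → Set Ω) :
    ⋃ s ∈ T, firstIn T A s = ⋃ s ∈ T, A s := by
  refine subset_antisymm (iUnion₂_mono fun s _ => sdiff_subset) fun ω hω => ?_
  classical
  simp only [mem_iUnion, exists_prop] at hω
  have hne : (T.filter (fun s => ω ∈ A s)).Nonempty := by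
    obtain ⟨s, h1, h2⟩ := hω
    exact ⟨s, by simp [h1, h2]⟩
  obtain ⟨s, hs, hmin⟩ := Finset.exists_min_image _ id hne
  rw [Finset.mem_filter] at hs
  refine mem_biUnion hs.1 ⟨hs.2, fun hc => ?_⟩
  simp only [Finset.mem_filter, mem_iUnion, exists_prop] at hc
  obtain ⟨v, ⟨hv, hvs⟩, hvA⟩ := hc
  exact (hmin v (by simp [hv, hvA])).not_gt hvs

/-- The σ-algebra of the path of `X` up to time `s`. -/
@[reducible]
def pastSigma (X : ℝ≥0 → Ω → Fin n → ℝ) (s : ℝ≥0) : MeasurableSpace Ω :=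
  MeasurableSpace.comap (fun ω (v : Iic s) => X v ω) inferInstance

theorem measurable_pastSigma (X : ℝ≥0 → Ω → Fin n → ℝ) {v s : ℝ≥0} (h : v ≤ s) :
    Measurable[pastSigma X s] (X v) := by
  have h1 : Measurable[pastSigma X s] (fun ω (v : Iic s) => X v ω) := comap_measurable _
  exact (measurable_pi_apply (⟨v, h⟩ : Iic s)).comp h1

theorem pastSigma_mono (X : ℝ≥0 → Ω → Fin n → ℝ) {v s : ℝ≥0} (h : v ≤ s) :
    pastSigma X v ≤ pastSigma X s := by
  refine Measurable.comap_le (m₁ := pastSigma X s) ?_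
  exact @measurable_pi_lambda _ _ _ (pastSigma X s) _ _ fun u =>
    measurable_pastSigma X (u.2.trans h)

theorem pastSigma_le [m : MeasurableSpace Ω] {X : ℝ≥0 → Ω → Fin n → ℝ}
    (hX : ∀ t, Measurable (X t)) (s : ℝ≥0) : pastSigma X s ≤ m :=
  Measurable.comap_le (measurable_pi_lambda _ fun u => hX u)

theorem measurableSet_pastSigma_lt (X : ℝ≥0 → Ω → Fin n → ℝ) (k : Fin n) (s : ℝ≥0) {f : Ω → ℝ}
    (hf : Measurable[pastSigma X s] f) :
    MeasurableSet[pastSigma X s] {ω | f ω < X s ω k} :=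
  measurableSet_lt (mδ := pastSigma X s) hf
    ((measurable_pi_apply k).comp (measurable_pastSigma X le_rfl))

theorem measurableSet_firstIn (X : ℝ≥0 → Ω → Fin n → ℝ) {T : Finset ℝ≥0} {A : ℝ≥0 → Set Ω}
    (hA : ∀ s ∈ T, MeasurableSet[pastSigma X s] (A s)) {s : ℝ≥0} (hs : s ∈ T) :
    MeasurableSet[pastSigma X s] (firstIn T A s) := by
  refine (hA s hs).diff (Finset.measurableSet_biUnion _ fun v hv => ?_)
  rw [Finset.mem_filter] at hv
  exact pastSigma_mono X hv.2.le _ (hA v hv.1)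

end PastSigma

section Markov

variable {Ω : Type*} [MeasurableSpace Ω] {n : ℕ} {μ : Measure Ω} [IsProbabilityMeasure μ]
variable {X : ℝ≥0 → Ω → Fin n → ℝ} (hX : IsLevyProcess X μ)
include hX

theorem IsLevyProcess.measure_past_inter_future {q : ℝ≥0} {F : Set Ω}
    (hF : MeasurableSet[pastSigma X q] F) {C : Set (ℝ≥0 → Fin n → ℝ)} (hC : MeasurableSet C) :
    μ (F ∩ {ω | (fun h => X (q + h) ω - X q ω) ∈ C}) = μ F * μ {ω | (fun h => X h ω) ∈ C} := by
  obtain ⟨B, hB, rfl⟩ := hF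
  have h1 := (hX.indep_past_future q).measure_inter_preimage_eq_mul B C hB hC
  have h2 : μ ((fun ω (h : ℝ≥0) => X (q + h) ω - X q ω) ⁻¹' C) = μ {ω | (fun h => X h ω) ∈ C} := by
    have hm : Measurable fun ω (h : ℝ≥0) => X (q + h) ω - X q ω :=
      measurable_pi_lambda _ fun h => (hX.measurable _).sub (hX.measurable _)
    rw [← Measure.map_apply hm hC, hX.map_shift q,
      Measure.map_apply (measurable_pi_lambda _ hX.measurable) hC]
    rfl
  rw [h2] at h1
  exact h1

/-- The Markov property at the first time in a finite set at which an adapted event occurs. -/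
theorem IsLevyProcess.measure_firstIn_inter {T : Finset ℝ≥0} {A : ℝ≥0 → Set Ω}
    (hA : ∀ s ∈ T, MeasurableSet[pastSigma X s] (A s)) {C : ℝ≥0 → Set (ℝ≥0 → Fin n → ℝ)}
    (hC : ∀ s, MeasurableSet (C s)) :
    μ (⋃ s ∈ T, firstIn T A s ∩ {ω | (fun h => X (s + h) ω - X s ω) ∈ C s}) =
      ∑ s ∈ T, μ (firstIn T A s) * μ {ω | (fun h => X h ω) ∈ C s} := by
  rw [measure_biUnion_finset]
  · exact Finset.sum_congr rfl fun s hs =>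
      hX.measure_past_inter_future (measurableSet_firstIn X hA hs) (hC s)
  · exact (pairwiseDisjoint_firstIn T A).mono fun s => inter_subset_left
  · intro s hs
    refine (pastSigma_le hX.measurable s _ (measurableSet_firstIn X hA hs)).inter ?_
    exact (measurable_pi_lambda _ fun h => (hX.measurable _).sub (hX.measurable _)) (hC s)

omit [IsProbabilityMeasure μ] in
theorem IsLevyProcess.measure_iUnion_eq_sum_firstIn {T : Finset ℝ≥0} {A : ℝ≥0 → Set Ω}
    (hA : ∀ s ∈ T, MeasurableSet[pastSigma X s] (A s)) :
    μ (⋃ s ∈ T, A s) = ∑ s ∈ T, μ (firstIn T A s) := by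
  rw [← iUnion_firstIn, measure_biUnion_finset (pairwiseDisjoint_firstIn T A) fun s hs =>
    pastSigma_le hX.measurable s _ (measurableSet_firstIn X hA hs)]

end Markov

/-! ### Drift to `-∞`. -/

section Drift

variable {Ω : Type*} [MeasurableSpace Ω] {n : ℕ} {μ : Measure Ω} [IsProbabilityMeasure μ]
  {X : ℝ≥0 → Ω → Fin n → ℝ} (hX : IsLevyProcess X μ) (k : Fin n)
include hX

omit [IsProbabilityMeasure μ] in
theorem IsLevyProcess.measurable_eval (t : ℝ≥0) : Measurable fun ω => X t ω k :=
  (measurable_pi_apply k).comp (hX.measurable t)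

/-- A Lévy process is uniformly tight from below on `[0, 1]`. -/
theorem IsLevyProcess.exists_tight :
    ∃ A : ℝ, 0 ≤ A ∧ ∀ s ≤ 1, μ {ω | X s ω k < - A} ≤ 1 / 2 := by
  -- The bound `2` rather than `1` leaves grid times to the right of `s = 1`.
  let G : ℕ → Set Ω := fun A => {ω | ∃ m, gridTime m < 2 ∧ X (gridTime m) ω k < - (A : ℝ)}
  have hG : ∀ A, MeasurableSet (G A) := fun A => by
    have : G A = ⋃ m, ⋃ _ : gridTime m < 2, {ω | X (gridTime m) ω k < - (A : ℝ)} := by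
      ext; simp [G]
    rw [this]
    exact MeasurableSet.iUnion fun m => MeasurableSet.iUnion fun _ =>
      measurableSet_lt (hX.measurable_eval k _) measurable_const
  have hanti : Antitone G := by
    rintro A B hAB ω ⟨m, h1, h2⟩
    exact ⟨m, h1, h2.trans_le (neg_le_neg (by exact_mod_cast hAB))⟩
  have hnull : μ (⋂ A, G A) = 0 := by
    rw [← nonpos_iff_eq_zero, ← (ae_iff.1 hX.cadlag)]
    refine measure_mono fun ω hω hc => ?_
    obtain ⟨C, hC⟩ := (IsCadlag.apply hc k).exists_bound 2
    obtain ⟨A, hA⟩ := exists_nat_gt C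
    obtain ⟨m, h1, h2⟩ := mem_iInter.1 hω A
    have := neg_le_of_abs_le (hC _ h1.le)
    linarith
  have hlim := tendsto_measure_iInter_atTop (fun A => (hG A).nullMeasurableSet) hanti
    ⟨0, measure_ne_top μ _⟩
  rw [hnull] at hlim
  obtain ⟨A, hA⟩ := (hlim.eventually_le_const (by norm_num : (0 : ℝ≥0∞) < 1 / 2)).exists
  refine ⟨A, Nat.cast_nonneg A, fun s hs => le_trans (measure_mono_ae ?_) hA⟩
  filter_upwards [hX.cadlag] with ω hω (h : X s ω k < - A)
  obtain ⟨m, h1, h2, h3⟩ := (hω.apply k).neg.exists_grid_gt (s := s) (u := 2) (a := A)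
    (hs.trans_lt (by norm_num)) (by linarith)
  exact ⟨m, h2, by linarith⟩

/-- Ottaviani's maximal inequality on the grid times of `[0, 1)`. -/
theorem IsLevyProcess.measure_exists_grid_gt_le {A : ℝ}
    (hA : ∀ s ≤ 1, μ {ω | X s ω k < - A} ≤ 1 / 2) (a : ℝ) :
    μ {ω | ∃ m, gridTime m < 1 ∧ a + A < X (gridTime m) ω k} ≤ 2 * μ {ω | a < X 1 ω k} := by
  let E : ℕ → Set Ω := fun M => {ω | ∃ m < M, gridTime m < 1 ∧ a + A < X (gridTime m) ω k}
  have hE : {ω | ∃ m, gridTime m < 1 ∧ a + A < X (gridTime m) ω k} = ⋃ M, E M := by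
    ext ω
    simp only [mem_ofPred_eq, E, mem_iUnion]
    exact ⟨fun ⟨m, h⟩ => ⟨m + 1, m, Nat.lt_succ_self m, h⟩, fun ⟨_, m, _, h⟩ => ⟨m, h⟩⟩
  have hmono : Monotone E := by
    rintro M N hMN ω ⟨m, h1, h2⟩
    exact ⟨m, h1.trans_le hMN, h2⟩
  rw [hE, hmono.measure_iUnion]
  refine iSup_le fun M => ?_
  let T : Finset ℝ≥0 := ((Finset.range M).image gridTime).filter (· < 1)
  let F : ℝ≥0 → Set Ω := fun s => {ω | a + A < X s ω k}
  have hF : ∀ s ∈ T, MeasurableSet[pastSigma X s] (F s) := fun s _ =>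
    measurableSet_pastSigma_lt X k s (@measurable_const _ _ _ (pastSigma X s) _)
  have hEM : E M = ⋃ s ∈ T, F s := by
    ext ω
    simp only [mem_ofPred_eq, E, T, F, mem_iUnion, Finset.mem_filter, Finset.mem_image,
      Finset.mem_range, exists_prop]
    constructor
    · rintro ⟨m, h1, h2, h3⟩
      exact ⟨_, ⟨⟨m, h1, rfl⟩, h2⟩, h3⟩
    · rintro ⟨_, ⟨⟨m, h1, rfl⟩, h2⟩, h3⟩
      exact ⟨m, h1, h2, h3⟩
  -- After first exceeding `a + A` at `s`, the remaining increment up to time `1` is at least `-A`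
  -- with probability at least `1 / 2`, and then `X 1` exceeds `a`.
  let C : ℝ≥0 → Set (ℝ≥0 → Fin n → ℝ) := fun s => {p | - A ≤ p (1 - s) k}
  have hC : ∀ s, MeasurableSet (C s) := fun s => measurableSet_le measurable_const
    ((measurable_pi_apply k).comp (measurable_pi_apply (1 - s)))
  have hCprob : ∀ s, 1 ≤ 2 * μ {ω | (fun h => X h ω) ∈ C s} := fun s => by
    have h1 := hA (1 - s) tsub_le_self
    have h2 : {ω | (fun h => X h ω) ∈ C s} = {ω | X (1 - s) ω k < - A}ᶜ := by
      ext ω; simp [C]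
    rw [h2, prob_compl_eq_one_sub (measurableSet_lt (hX.measurable_eval k _) measurable_const)]
    calc (1 : ℝ≥0∞) = 2 * (1 - 1 / 2) := by
          rw [one_div, ENNReal.one_sub_inv_two, ENNReal.mul_inv_cancel (by norm_num) (by norm_num)]
      _ ≤ _ := by gcongr
  calc μ (E M) = ∑ s ∈ T, μ (firstIn T F s) := by
        rw [hEM, hX.measure_iUnion_eq_sum_firstIn hF]
    _ ≤ ∑ s ∈ T, 2 * (μ (firstIn T F s) * μ {ω | (fun h => X h ω) ∈ C s}) := by
        refine Finset.sum_le_sum fun s _ => ?_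
        calc μ (firstIn T F s) = μ (firstIn T F s) * 1 := (mul_one _).symm
          _ ≤ μ (firstIn T F s) * (2 * μ {ω | (fun h => X h ω) ∈ C s}) := by gcongr; exact hCprob s
          _ = _ := by ring
    _ = 2 * μ (⋃ s ∈ T, firstIn T F s ∩ {ω | (fun h => X (s + h) ω - X s ω) ∈ C s}) := by
        rw [hX.measure_firstIn_inter hF hC, Finset.mul_sum]
    _ ≤ 2 * μ {ω | a < X 1 ω k} := by
        gcongr
        intro ω hω
        simp only [mem_iUnion, exists_prop] at hω
        obtain ⟨s, hs, h1, h2⟩ := hω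
        have hs1 : s < 1 := by simp only [T, Finset.mem_filter] at hs; exact hs.2
        have h3 : a + A < X s ω k := h1.1
        have h4 : - A ≤ X (s + (1 - s)) ω k - X s ω k := h2
        rw [add_tsub_cancel_of_le hs1.le] at h4
        simp only [mem_ofPred_eq]
        linarith

/-- An integrable Lévy process with negative mean drifts to `-∞`. -/
theorem IsLevyProcess.tendsto_atBot (hint : Integrable (fun ω => X 1 ω k) μ)
    (hneg : ∫ ω, X 1 ω k ∂μ < 0) : ∀ᵐ ω ∂μ, Tendsto (fun t => X t ω k) atTop atBot := by
  set m := ∫ ω, X 1 ω k ∂μ with hm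
  -- One `ε` pays for the law of large numbers and one for fluctuations, leaving slope `m + 2 * ε =
  -- m / 2 < 0`.
  set ε := - m / 4 with hε
  have hε0 : 0 < ε := by simp only [hε]; linarith
  -- law of large numbers along the integers
  have hslln : ∀ᵐ ω ∂μ, Tendsto (fun N : ℕ => X N ω k / N) atTop (𝓝 m) := by
    let ξ : ℕ → Ω → ℝ := fun i ω => X ((i + 1 : ℕ) : ℝ≥0) ω k - X (i : ℝ≥0) ω k
    have hid : ∀ i, IdentDistrib (ξ i) (fun ω => X 1 ω k) μ μ := fun i => by
      have := (hX.stationary i 1).comp (measurable_pi_apply k)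
      simpa [Function.comp_def, ξ] using this
    have hind : iIndepFun ξ μ := by
      have := (hX.indep.nat (t := fun i : ℕ => (i : ℝ≥0)) Nat.mono_cast).comp
        (fun _ x => x k) (fun _ => measurable_pi_apply k)
      exact this
    have h0 : Integrable (ξ 0) μ := (hid 0).integrable_iff.2 hint
    have := strong_law_ae_real ξ h0 (fun i j hij => hind.indepFun hij)
      (fun i => (hid i).trans (hid 0).symm)
    rw [(hid 0).integral_eq] at this
    filter_upwards [this, hX.zero] with ω h1 h2
    refine h1.congr fun N => ?_
    rw [Finset.sum_range_sub (fun i : ℕ => X (i : ℝ≥0) ω k)]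
    simp [h2]
  obtain ⟨A, hA0, hA⟩ := hX.exists_tight k
  -- fluctuations between integers
  let D : ℕ → Set Ω := fun i => {ω | ∃ l, gridTime l < 1 ∧
    (ε * i - A) + A < X (i + gridTime l) ω k - X i ω k}
  have hD : ∀ i, μ (D i) ≤ 2 * μ {ω | ε * i - A < X 1 ω k} := fun i => by
    refine le_trans (le_of_eq ?_) (hX.measure_exists_grid_gt_le k hA (ε * i - A))
    let C : Set (ℝ≥0 → Fin n → ℝ) := ⋃ l, ⋃ _ : gridTime l < 1,
      {p | (ε * i - A) + A < p (gridTime l) k}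
    have hC : MeasurableSet C := MeasurableSet.iUnion fun l => MeasurableSet.iUnion fun _ =>
      measurableSet_lt measurable_const ((measurable_pi_apply k).comp (measurable_pi_apply _))
    have e1 := hX.measure_past_inter_future (q := i) (F := univ) MeasurableSet.univ hC
    rw [univ_inter, measure_univ, one_mul] at e1
    convert e1 using 2
    · ext ω; simp [D, C]
    · ext ω; simp [C]
  -- The tail probabilities of the integrable `X 1` along `ε * i - A` are summable, so
  -- Borel–Cantelli applies to `D`.
  have hsum : ∑' i, μ (D i) ≠ ∞ := by
    refine ne_of_lt (lt_of_le_of_lt (ENNReal.tsum_le_tsum hD) ?_)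
    rw [ENNReal.tsum_mul_left]
    refine ENNReal.mul_lt_top (by simp) ?_
    let _ : MeasureSpace Ω := ⟨μ⟩
    let Z : Ω → ℝ := fun ω => max ((X 1 ω k + A) / ε) 0
    have hZ : Integrable Z := ((hint.add (integrable_const A)).div_const ε).pos_part
    refine lt_of_le_of_lt (ENNReal.tsum_le_tsum fun i => ?_)
      (tsum_prob_mem_Ioi_lt_top hZ fun ω => le_max_right _ _)
    refine measure_mono fun ω (hω : ε * i - A < X 1 ω k) => ?_
    change (i : ℝ) < max ((X 1 ω k + A) / ε) 0
    refine lt_max_of_lt_left ?_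
    rw [lt_div_iff₀ hε0]
    linarith
  filter_upwards [hslln, ae_eventually_notMem hsum, hX.cadlag] with ω h1 h2 h3
  have hx := h3.apply k
  have h4 : ∀ᶠ N : ℕ in atTop, X N ω k / N < m + ε := h1.eventually_lt_const (by linarith)
  obtain ⟨N0, hN0⟩ := eventually_atTop.1 (h4.and h2)
  refine Filter.tendsto_atBot.2 fun b => ?_
  obtain ⟨N1, hN1⟩ := exists_nat_gt (b / (m + 2 * ε))
  filter_upwards [eventually_ge_atTop ((max (max N0 N1) 1 : ℕ) : ℝ≥0)] with t ht
  set N := ⌊t⌋₊ with hN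
  have hNle : max (max N0 N1) 1 ≤ N := Nat.le_floor ht
  have hNN0 : N0 ≤ N := (le_max_left _ _).trans ((le_max_left _ _).trans hNle)
  have hNN1 : N1 ≤ N := (le_max_right _ _).trans ((le_max_left _ _).trans hNle)
  have hN1' : (0 : ℝ) < N := by exact_mod_cast (le_max_right _ _).trans hNle
  obtain ⟨h5, h6⟩ := hN0 N hNN0
  rw [div_lt_iff₀ hN1'] at h5
  have hNt : (N : ℝ≥0) ≤ t := Nat.floor_le zero_le
  have htN : t < N + 1 := Nat.lt_floor_add_one t
  -- A violation at `t` persists at a grid offset from `N` just after `t`, hence puts `ω` in `D N`.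
  have h7 : X t ω k - X N ω k ≤ ε * N := by
    by_contra hc
    obtain ⟨u, hu, H⟩ := hx.exists_lt_near (t := t) (C := X N ω k + ε * N) (by linarith)
    have hlt : t - N < min u (N + 1) - N := by
      refine (tsub_lt_tsub_iff_right hNt).2 (lt_min hu htN)
    obtain ⟨l, hl1, hl2⟩ := exists_gridTime_between hlt
    have hl3 : gridTime l < 1 := hl2.trans_le (by
      rw [tsub_le_iff_left]; exact min_le_right _ _)
    have hl4 : t < N + gridTime l := by
      rwa [tsub_lt_iff_left hNt] at hl1
    have hl5 : N + gridTime l < u := by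
      rw [lt_tsub_iff_left] at hl2
      exact hl2.trans_le (min_le_left _ _)
    have := H _ hl4.le hl5
    exact h6 ⟨l, hl3, by linarith⟩
  have h8 : X t ω k ≤ (m + 2 * ε) * N := by linarith
  have h9 : m + 2 * ε < 0 := by simp only [hε]; linarith
  refine h8.trans ?_
  have h10 : b / (m + 2 * ε) < N := hN1.trans_le (by exact_mod_cast hNN1)
  rw [div_lt_iff_of_neg h9] at h10
  linarith

end Drift

/-! ### Quasi-left-continuity and accumulation of zeros. -/

theorem measure_iUnion_iInter_ge_le {Ω : Type*} [MeasurableSpace Ω] {μ : Measure Ω} {s : ℕ → Set Ω}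
    {p : ℝ≥0∞} (h : ∀ k, μ (s k) ≤ p) : μ (⋃ M, ⋂ m ≥ M, s m) ≤ p := by
  have hmono : Monotone fun M => ⋂ m ≥ M, s m := fun M N hMN =>
    biInter_mono (fun m (hm : m ≥ N) => hMN.trans hm) fun _ _ => le_rfl
  rw [hmono.measure_iUnion]
  exact iSup_le fun M => (measure_mono (biInter_subset_of_mem (le_refl M))).trans (h M)

/-- Shows that the regulator at `q` is measurable with respect to the path up to `q`. -/
theorem IsCadlag.regulator_eq_grid {y : ℝ≥0 → ℝ} (hy : IsCadlag y) (q : ℝ≥0) :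
    regulator y q =
      max 0 (max (- y q) (⨆ m, if gridTime m < q then - y (gridTime m) else 0)) := by
  have hb : BddAbove (range fun m => if gridTime m < q then - y (gridTime m) else 0) := by
    refine ⟨regulator y q, ?_⟩
    rintro _ ⟨m, rfl⟩
    dsimp only
    split_ifs with h
    · exact hy.neg_le_regulator h.le
    · exact regulator_nonneg _ _
  refine le_antisymm (regulator_le (le_max_left _ _) fun s hs => le_max_of_le_right ?_)
    (max_le (regulator_nonneg _ _) (max_le (hy.neg_le_regulator le_rfl) (ciSup_le fun m => ?_)))
  · rcases hs.eq_or_lt with rfl | hs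
    · exact le_max_left _ _
    · refine le_max_of_le_right (not_lt.1 fun hc => ?_)
      obtain ⟨m, -, h2, h3⟩ := hy.neg.exists_grid_gt hs hc
      have := le_ciSup hb m
      rw [if_pos h2] at this
      linarith
  · split_ifs with h
    · exact hy.neg_le_regulator h.le
    · exact regulator_nonneg _ _

/-- If the left-limit zeros of the reflected path that are first after a grid time are zeros, then
`ZerosAccumulate` holds. -/
theorem IsCadlag.zerosAccumulate {y : ℝ≥0 → ℝ} (hy : IsCadlag y)
    (h : ∀ i j : ℕ, ¬ ∃ s > gridTime i,
      (∀ s' < s, ∃ δ > 0, ∀ v ∈ Icc (gridTime i) s', - regulator y (gridTime i) + δ ≤ y v) ∧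
      Tendsto y (𝓝[<] s) (𝓝 (- regulator y (gridTime i))) ∧
      - regulator y (gridTime i) + 2 * (1 / ((j : ℝ) + 1)) < y s) : ZerosAccumulate y := by
  intro s hs hlim hne a ha
  by_contra hcon
  push Not at hcon
  obtain ⟨i, hi1, hi2⟩ := exists_gridTime_between ha
  set q := gridTime i with hq
  set R := regulator y q with hR
  -- With no zeros from `q` to `s` the regulator is frozen at `R`, so the left-limit zero at `s` is
  -- an approach of `y` to the level `-R` known at time `q`.
  have hreg : ∀ v ∈ Icc q s, regulator y v = R := fun v hv => by
    refine (hy.regulator_eq_of_pos hv.1 fun u hu => ?_).symm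
    rcases (hu.2.trans hv.2).eq_or_lt with h1 | h1
    · exact h1 ▸ hne
    · exact hcon u ⟨hi1.trans hu.1, h1⟩
  have hpos : ∀ v ∈ Icc q s, - R < y v := fun v hv => by
    have h1 : reflected y v ≠ 0 := by
      rcases hv.2.eq_or_lt with h1 | h1
      · exact h1 ▸ hne
      · exact hcon v ⟨hi1.trans_le hv.1, h1⟩
    have h2 := lt_of_le_of_ne (hy.reflected_nonneg v) h1.symm
    simp only [reflected, hreg v hv] at h2
    linarith
  have hlim' : Tendsto y (𝓝[<] s) (𝓝 (- R)) := by
    have h1 : Tendsto (fun v => reflected y v - R) (𝓝[<] s) (𝓝 (- R)) := by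
      simpa using hlim.sub_const R
    refine h1.congr' ?_
    filter_upwards [Ioo_mem_nhdsLT hi2] with v hv
    simp [reflected, hreg v ⟨hv.1.le, hv.2.le⟩]
  set S := {v | v ∈ Ioc q s ∧ Tendsto y (𝓝[<] v) (𝓝 (- R))} with hS
  have hSne : S.Nonempty := ⟨s, ⟨hi2, le_rfl⟩, hlim'⟩
  set s1 := sInf S with hs1
  have hs1q : q ≤ s1 := le_csInf hSne fun v hv => hv.1.1.le
  have hs1s : s1 ≤ s := csInf_le (OrderBot.bddBelow S) ⟨⟨hi2, le_rfl⟩, hlim'⟩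
  -- The first approach is attained: right continuity keeps `y` above some `e > -R` just after `s1`,
  -- so approach times cannot decrease to `s1`.
  have hmem : s1 ∈ S := by
    obtain ⟨e, he1, he2⟩ := exists_between (hpos s1 ⟨hs1q, hs1s⟩)
    obtain ⟨u, hu, H⟩ := hy.exists_lt_near he2
    obtain ⟨v, hv, hvu⟩ := exists_lt_of_csInf_lt hSne (show sInf S < u from hu)
    rcases (csInf_le (OrderBot.bddBelow S) hv).eq_or_lt with h1 | h1
    · rw [hs1, h1]; exact hv
    · exfalso
      have hNB : (𝓝[<] v).NeBot := nhdsLT_neBot_of_exists_lt ⟨s1, h1⟩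
      have : e ≤ - R := ge_of_tendsto hv.2 (by
        filter_upwards [Ioo_mem_nhdsLT h1] with w hw
        exact (H w hw.1.le (hw.2.trans hvu)).le)
      linarith
  obtain ⟨j, hj⟩ := exists_nat_one_div_lt (show 0 < (y s1 + R) / 2 by
    linarith [hpos s1 ⟨hs1q, hs1s⟩])
  refine h i j ⟨s1, hmem.1.1, fun s' hs' => ?_, hmem.2, by linarith⟩
  refine hy.exists_gap (fun v hv => hpos v ⟨hv.1, hv.2.trans (hs'.le.trans hs1s)⟩) fun v hv hc => ?_
  have : v ∈ S := ⟨⟨hv.1, hv.2.trans (hs'.le.trans hs1s)⟩, hc⟩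
  exact (csInf_le (OrderBot.bddBelow S) this).not_gt (hv.2.trans_lt hs')

section QuasiLeft

variable {Ω : Type*} [MeasurableSpace Ω] {n : ℕ} {μ : Measure Ω} [IsProbabilityMeasure μ]
  {X : ℝ≥0 → Ω → Fin n → ℝ} (hX : IsLevyProcess X μ) (k : Fin n)

/-- Paths exceeding `ε` on the grid times before `η`. -/
def earlyExceed (k : Fin n) (ε : ℝ) (η : ℝ≥0) : Set (ℝ≥0 → Fin n → ℝ) :=
  ⋃ l, ⋃ _ : gridTime l < η, {p | ε < p (gridTime l) k}

theorem measurableSet_earlyExceed (ε : ℝ) (η : ℝ≥0) : MeasurableSet (earlyExceed k ε η) :=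
  MeasurableSet.iUnion fun _ => MeasurableSet.iUnion fun _ =>
    measurableSet_lt measurable_const ((measurable_pi_apply k).comp (measurable_pi_apply _))

include hX

/-- Right continuity at `0`, where the path vanishes. -/
theorem IsLevyProcess.tendsto_earlyExceed {ε : ℝ} (hε : 0 < ε) :
    Tendsto (fun j : ℕ => μ {ω | (fun h => X h ω) ∈ earlyExceed k ε (1 / ((j : ℝ≥0) + 1))}) atTop
      (𝓝 0) := by
  let G : ℕ → Set Ω := fun j => {ω | (fun h => X h ω) ∈ earlyExceed k ε (1 / ((j : ℝ≥0) + 1))}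
  have hm : ∀ j, MeasurableSet (G j) := fun j =>
    (measurable_pi_lambda _ hX.measurable) (measurableSet_earlyExceed k ε _)
  have hanti : Antitone G := by
    intro i j hij ω hω
    simp only [G, earlyExceed, mem_ofPred_eq, mem_iUnion, exists_prop] at hω ⊢
    obtain ⟨l, h1, h2⟩ := hω
    exact ⟨l, h1.trans_le (by gcongr), h2⟩
  have hnull : μ (⋂ j, G j) = 0 := by
    rw [← nonpos_iff_eq_zero, ← (ae_iff.1 (hX.cadlag.and hX.zero))]
    refine measure_mono fun ω hω hc => ?_
    obtain ⟨u, hu, H⟩ := (hc.1.apply k).exists_gt_near (t := 0) (C := ε) (by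
      simpa [hc.2] using hε)
    obtain ⟨j, hj⟩ := exists_nat_one_div_lt hu
    have := mem_iInter.1 hω j
    simp only [G, earlyExceed, mem_ofPred_eq, mem_iUnion, exists_prop] at this
    obtain ⟨l, h1, h2⟩ := this
    exact lt_asymm h2 (H _ zero_le (h1.trans hj))
  have := tendsto_measure_iInter_atTop (fun A => (hm A).nullMeasurableSet) hanti
    ⟨0, measure_ne_top μ _⟩
  rwa [hnull] at this

/-- Quasi-left-continuity at first approaches of a level: a Lévy process does not jump at the
moment when it first approaches, from above and continuously, a level known at time `q`. -/
theorem IsLevyProcess.ae_not_jump_at_first_approach (q : ℝ≥0) {a : Ω → ℝ}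
    (ha : Measurable[pastSigma X q] a) {ε : ℝ} (hε : 0 < ε) :
    ∀ᵐ ω ∂μ, ¬ ∃ s > q, (∀ s' < s, ∃ δ > 0, ∀ v ∈ Icc q s', a ω + δ ≤ X v ω k) ∧
      Tendsto (fun v => X v ω k) (𝓝[<] s) (𝓝 (a ω)) ∧ a ω + 2 * ε < X s ω k := by
  -- No measurability of `bad` is claimed; only upper bounds on its outer measure are used.
  set bad : Set Ω := {ω | IsCadlag (fun t => X t ω) ∧ ∃ s > q,
    (∀ s' < s, ∃ δ > 0, ∀ v ∈ Icc q s', a ω + δ ≤ X v ω k) ∧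
      Tendsto (fun v => X v ω k) (𝓝[<] s) (𝓝 (a ω)) ∧ a ω + 2 * ε < X s ω k} with hbad
  suffices h : μ bad = 0 by
    filter_upwards [measure_eq_zero_iff_ae_notMem.1 h, hX.cadlag] with ω h1 h2 h3
    exact h1 ⟨h2, h3⟩
  let T : ℕ → Finset ℝ≥0 := fun N => ((Finset.range N).image gridTime).filter (q < ·)
  let A : ℕ → ℝ≥0 → Set Ω := fun m s => {ω | X s ω k < a ω + 1 / ((m : ℝ) + 1)}
  have hA : ∀ m N, ∀ s ∈ T N, MeasurableSet[pastSigma X s] (A m s) := fun m N s hs => by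
    have hqs : q < s := by simp only [T, Finset.mem_filter] at hs; exact hs.2
    have ha' : Measurable[pastSigma X s] a := ha.mono (pastSigma_mono X hqs.le) le_rfl
    exact measurableSet_lt (mδ := pastSigma X s)
      ((measurable_pi_apply k).comp (measurable_pastSigma X le_rfl)) (ha'.add_const _)
  have hbound : ∀ j : ℕ, μ bad ≤
      μ {ω | (fun h => X h ω) ∈ earlyExceed k ε (1 / ((j : ℝ≥0) + 1))} := by
    intro j
    set η : ℝ≥0 := 1 / ((j : ℝ≥0) + 1) with hη
    have hη0 : 0 < η := by positivity
    -- From the first time in `T N` below `a + 1 / (m + 1)`, the path rises by more than `ε` within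
    -- `η`. By the Markov property this is no likelier than such a rise at time `0`.
    let E : ℕ → ℕ → Set Ω := fun m N => ⋃ s ∈ T N, firstIn (T N) (A m) s ∩
      {ω | (fun h => X (s + h) ω - X s ω) ∈ earlyExceed k ε η}
    have hE : ∀ m N, μ (E m N) ≤ μ {ω | (fun h => X h ω) ∈ earlyExceed k ε η} := fun m N => by
      have e := hX.measure_firstIn_inter (hA m N) (C := fun _ => earlyExceed k ε η)
        fun _ => measurableSet_earlyExceed k ε η
      simp only [E]
      rw [e, ← Finset.sum_mul, ← hX.measure_iUnion_eq_sum_firstIn (hA m N)]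
      calc _ ≤ 1 * μ {ω | (fun h => X h ω) ∈ earlyExceed k ε η} := by gcongr; exact prob_le_one
        _ = _ := one_mul _
    refine le_trans (measure_mono ?_)
      (measure_iUnion_iInter_ge_le fun m => measure_iUnion_iInter_ge_le fun N => hE m N)
    -- For large `m` and `N`, the first grid time `σ` near the level lies in `(s - η, s)`, as the
    -- gap `δ` excludes earlier ones. The jump at `s` then gives a rise above `2 * ε - 1 / (m + 1) >
    -- ε`.
    rintro ω ⟨hc, s, hqs, h1, h2, h3⟩
    have hx := hc.apply k
    have hs0 : 0 < s := lt_of_le_of_lt zero_le hqs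
    have hs' : max q (s - η) < s := max_lt hqs (tsub_lt_self hs0 hη0)
    obtain ⟨δ, hδ, hgap⟩ := h1 _ hs'
    obtain ⟨m0, hm0⟩ := exists_nat_one_div_lt (lt_min hδ hε)
    refine mem_iUnion.2 ⟨m0, mem_iInter₂.2 fun m hm => ?_⟩
    have hm1 : 1 / ((m : ℝ) + 1) < min δ ε := lt_of_le_of_lt (by gcongr) hm0
    obtain ⟨v0, hv0, hv⟩ := (mem_nhdsLT_iff_exists_Ioo_subset' hs0).1
      (h2.eventually_lt_const (show a ω < a ω + 1 / ((m : ℝ) + 1) by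
        have : 0 < 1 / ((m : ℝ) + 1) := by positivity
        linarith))
    obtain ⟨i, hi1, hi2⟩ := exists_gridTime_between (max_lt hv0 hs')
    refine mem_iUnion.2 ⟨i + 1, mem_iInter₂.2 fun N hN => ?_⟩
    have hiT : gridTime i ∈ T N := by
      simp only [T, Finset.mem_filter, Finset.mem_image, Finset.mem_range]
      exact ⟨⟨i, hN, rfl⟩, ((le_max_left _ _).trans (le_max_right _ _)).trans_lt hi1⟩
    have hiA : ω ∈ A m (gridTime i) := hv ⟨(le_max_left _ _).trans_lt hi1, hi2⟩
    have hU : ω ∈ ⋃ s ∈ T N, firstIn (T N) (A m) s := by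
      rw [iUnion_firstIn]
      exact mem_biUnion hiT hiA
    simp only [mem_iUnion, exists_prop] at hU
    obtain ⟨σ, hσT, hσ⟩ := hU
    refine mem_biUnion hσT ⟨hσ, ?_⟩
    have hσA : X σ ω k < a ω + 1 / ((m : ℝ) + 1) := hσ.1
    have hσs : σ < s := by
      refine lt_of_le_of_lt (not_lt.1 fun hc' => hσ.2 ?_) hi2
      exact mem_biUnion (by rw [Finset.mem_coe, Finset.mem_filter]; exact ⟨hiT, hc'⟩) hiA
    have hqσ : q < σ := by simp only [T, Finset.mem_filter] at hσT; exact hσT.2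
    have hσ' : s - η < σ := by
      refine (le_max_right q _).trans_lt (not_le.1 fun hc' => ?_)
      have := hgap σ ⟨hqσ.le, hc'⟩
      linarith [min_le_left δ ε]
    obtain ⟨u, hu, H⟩ := hx.exists_lt_near h3
    have hlt : s - σ < min (u - σ) η := by
      refine lt_min ((tsub_lt_tsub_iff_right hσs.le).2 hu) ?_
      rw [tsub_lt_iff_left hσs.le]
      exact lt_add_of_tsub_lt_right hσ'
    obtain ⟨l, hl1, hl2⟩ := exists_gridTime_between hlt
    have hl3 : s < σ + gridTime l := by rwa [tsub_lt_iff_left hσs.le] at hl1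
    have hl4 : σ + gridTime l < u := lt_tsub_iff_left.1 (hl2.trans_le (min_le_left _ _))
    have h5 := H _ hl3.le hl4
    simp only [earlyExceed, mem_ofPred_eq, mem_iUnion, exists_prop]
    refine ⟨l, hl2.trans_le (min_le_right _ _), ?_⟩
    simp only [Pi.sub_apply]
    linarith [min_le_right δ ε]
  exact le_antisymm (ge_of_tendsto' (hX.tendsto_earlyExceed k hε) hbound) zero_le

/-- Only countably many levels (regulators at grid times) and jump sizes have to be excluded. -/
theorem IsLevyProcess.ae_zerosAccumulate (c : ℝ) :
    ∀ᵐ ω ∂μ, ZerosAccumulate fun t => c + X t ω k := by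
  let a : ℕ → Ω → ℝ := fun i ω => - max 0 (max (- (c + X (gridTime i) ω k))
    (⨆ m, if gridTime m < gridTime i then - (c + X (gridTime m) ω k) else 0)) - c
  have ha : ∀ i, Measurable[pastSigma X (gridTime i)] (a i) := fun i => by
    let _ : MeasurableSpace Ω := pastSigma X (gridTime i)
    have hm : ∀ s ≤ gridTime i, Measurable fun ω => - (c + X s ω k) := fun s hs =>
      (((measurable_pi_apply k).comp (measurable_pastSigma X hs)).const_add c).neg
    refine ((measurable_const.max ((hm _ le_rfl).max (Measurable.iSup fun m => ?_))).neg).sub_const c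
    split_ifs with h
    · exact hm _ h.le
    · exact measurable_const
  have hall : ∀ᵐ ω ∂μ, ∀ i j : ℕ, _ := ae_all_iff.2 fun i => ae_all_iff.2 fun j : ℕ =>
    hX.ae_not_jump_at_first_approach k (gridTime i) (ha i)
      (show 0 < 1 / ((j : ℝ) + 1) by positivity)
  filter_upwards [hall, hX.cadlag] with ω h1 h2
  have hy : IsCadlag fun t => c + X t ω k :=
    (Continuous.isCadlag continuous_const).add (h2.apply k)
  refine hy.zerosAccumulate fun i j ⟨s, hs, e1, e2, e3⟩ => h1 i j ⟨s, hs, ?_⟩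
  have hai : a i ω = - regulator (fun t => c + X t ω k) (gridTime i) - c := by
    rw [hy.regulator_eq_grid]
  rw [hai]
  refine ⟨fun s' hs' => ?_, ?_, by linarith⟩
  · obtain ⟨δ, hδ, H⟩ := e1 s' hs'
    exact ⟨δ, hδ, fun v hv => by linarith [H v hv]⟩
  · simpa using e2.sub_const c

end QuasiLeft

/-! ### No upward jump at a fixed time. -/

section FixedTime

variable {Ω : Type*} [MeasurableSpace Ω] {n : ℕ} {μ : Measure Ω} [IsProbabilityMeasure μ]
  {X : ℝ≥0 → Ω → Fin n → ℝ} (hX : IsLevyProcess X μ) (k : Fin n)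
include hX

/-- A Lévy process has no upward jump at a fixed time. -/
theorem IsLevyProcess.ae_not_jump_at {t : ℝ≥0} (ht : 0 < t) :
    ∀ᵐ ω ∂μ, ∀ l, Tendsto (fun s => X s ω k) (𝓝[<] t) (𝓝 l) → X t ω k ≤ l := by
  have key : ∀ i : ℕ, ∀ᵐ ω ∂μ, ¬ ∃ l, Tendsto (fun s => X s ω k) (𝓝[<] t) (𝓝 l) ∧
      l + 1 / ((i : ℝ) + 1) < X t ω k := by
    intro i
    set ε : ℝ := 1 / ((i : ℝ) + 1) with hε
    have hε0 : 0 < ε := by positivity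
    have hbound : ∀ᶠ j : ℕ in atTop, μ {ω | ∃ l, Tendsto (fun s => X s ω k) (𝓝[<] t) (𝓝 l) ∧
        l + ε < X t ω k} ≤
        μ {ω | (fun h => X h ω) ∈ earlyExceed k ε (1 / ((j : ℝ≥0) + 1))} := by
      obtain ⟨j0, hj0⟩ := exists_nat_one_div_lt ht
      filter_upwards [eventually_ge_atTop j0] with j hj
      set η : ℝ≥0 := 1 / ((j : ℝ≥0) + 1) with hη
      have hη0 : 0 < η := by positivity
      have hηt : η < t := lt_of_le_of_lt (by rw [hη]; gcongr) hj0
      have hC := measurableSet_earlyExceed k ε η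
      have hm1 : Measurable fun ω (s : ℝ≥0) => X t ω - X (t - s) ω :=
        measurable_pi_lambda _ fun s => (hX.measurable _).sub (hX.measurable _)
      have hm2 : Measurable fun ω (s : ℝ≥0) => X (min s t) ω :=
        measurable_pi_lambda _ fun s => hX.measurable _
      -- Reversal at `t` turns a jump at `t` into an early rise from `0`; `η < t` makes the stopping
      -- at `t` invisible.
      have e : μ ((fun ω (s : ℝ≥0) => X t ω - X (t - s) ω) ⁻¹' earlyExceed k ε η) =
          μ {ω | (fun h => X h ω) ∈ earlyExceed k ε η} := by
        rw [← Measure.map_apply hm1 hC, hX.map_reversed t, Measure.map_apply hm2 hC]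
        congr 1
        ext ω
        simp only [earlyExceed, mem_preimage, mem_ofPred_eq, mem_iUnion, exists_prop]
        refine exists_congr fun l => and_congr_right fun hl => ?_
        rw [min_eq_left (hl.trans hηt).le]
      rw [← e]
      refine measure_mono ?_
      rintro ω ⟨l, h1, h2⟩
      obtain ⟨v, hv, H⟩ := (mem_nhdsLT_iff_exists_Ioo_subset' ht).1
        (h1.eventually_lt_const (show l < X t ω k - ε by linarith))
      have hlt : 0 < min η (t - v) := lt_min hη0 (tsub_pos_of_lt hv)
      obtain ⟨m, hm1, hm2⟩ := exists_gridTime_between hlt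
      have h3 : X (t - gridTime m) ω k < X t ω k - ε := H
        ⟨lt_tsub_comm.1 (hm2.trans_le (min_le_right _ _)), tsub_lt_self ht hm1⟩
      simp only [earlyExceed, mem_preimage, mem_iUnion, exists_prop]
      refine ⟨m, hm2.trans_le (min_le_left _ _), ?_⟩
      simp only [mem_ofPred_eq, Pi.sub_apply]
      linarith
    have := ge_of_tendsto (hX.tendsto_earlyExceed k hε0) hbound
    exact measure_eq_zero_iff_ae_notMem.1 (le_antisymm this zero_le)
  filter_upwards [ae_all_iff.2 key] with ω h l hl
  by_contra hc
  obtain ⟨i, hi⟩ := exists_nat_one_div_lt (sub_pos.2 (not_le.1 hc))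
  exact h i ⟨l, hl, by linarith⟩

end FixedTime

/-- Before `t` the regulator is bounded by `-l`, with `l` the left limit; since `y t ≤ l`, the
running maximum at `t` is `-y t`. -/
theorem IsCadlag.reflected_eq_zero_of_left {y : ℝ≥0 → ℝ} (hy : IsCadlag y) {a t : ℝ≥0}
    (hat : a < t) (h : ∀ v ∈ Ioo a t, reflected y v = 0)
    (hj : ∀ l, Tendsto y (𝓝[<] t) (𝓝 l) → y t ≤ l) : reflected y t = 0 := by
  obtain ⟨-, l, hl⟩ := hy t
  have hNB : (𝓝[<] t).NeBot := nhdsLT_neBot_of_exists_lt ⟨a, hat⟩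
  have hyt := hj l hl
  have hle : ∀ v < t, regulator y v ≤ - l := fun v hv => by
    refine ge_of_tendsto hl.neg ?_
    filter_upwards [Ioo_mem_nhdsLT (max_lt hat hv)] with w hw
    have h1 := h w ⟨(le_max_left _ _).trans_lt hw.1, hw.2⟩
    have h2 := hy.regulator_mono ((le_max_right a v).trans hw.1.le)
    simp only [reflected] at h1
    linarith
  have : regulator y t ≤ - y t := regulator_le
    (by linarith [regulator_nonneg y a, hle a hat]) fun v hv => by
      rcases hv.eq_or_lt with rfl | hv
      · exact le_rfl
      · linarith [hy.neg_le_regulator (le_refl v), hle v hv]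
  have h2 := hy.reflected_nonneg t
  simp only [reflected] at h2 ⊢
  linarith

/-! ### Own contents against aggregated contents. -/

section Compare

variable {Ω : Type*} [MeasurableSpace Ω] {n : ℕ} {μ : Measure Ω} {J : ℝ≥0 → Ω → Fin n → ℝ}
  {r : Fin n → ℝ} {P : Matrix (Fin n) (Fin n) ℝ} {w : Fin n → ℝ} {Jp W L : ℝ≥0 → Fin n → ℝ}
  (h : IsTreeFluidNetwork μ J r P) (hrate : ∀ i j, 0 < P i j → r j / r i < P i j)
  (hmono : ∀ j : Fin n, 0 < (j : ℕ) → Monotone fun t => Jp t j) (hJp : IsCadlag Jp)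
  (hJ0 : Jp 0 = 0) (hw : 0 ≤ w) (hS : IsSkorokhodSolution (1 - Pᵀ) w (netInput r P Jp) W L)
include h hrate hmono hJp hJ0 hw hS

/-- Under strict rate conditions, a station either carries its own aggregated content or is fed by
a reflected path. -/
theorem IsSkorokhodSolution.feed_cases (j : Fin n) :
    (∀ t, W t j = reflected (freeContent r P w Jp j) t) ∨
    ∃ (A u : ℝ≥0 → ℝ) (p κ : ℝ), 0 < p ∧ 0 < κ ∧ IsCadlag u ∧
      (∀ s t : ℝ≥0, s ≤ t → κ * (t - s) ≤ A t - A s) ∧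
      freeContent r P w Jp j = (fun s => A s + p * u s) ∧
      ∀ s, W s j = A s - p * regulator u s + regulator (fun s => A s + p * u s) s := by
  have hrate' : ∀ i j, 0 < P i j → r j / r i ≤ P i j := fun i j hp => (hrate i j hp).le
  have hWeq : ∀ s, W s j = ((1 - Pᵀ) *ᵥ aggregate P W s) j := fun s => by
    rw [IsSkorokhodSolution.mulVec_aggregate h]
  have hagg := hS.aggregate_eq_reflected h hrate' hmono hJp hJ0 hw
  rcases h.feeder j with hx | ⟨i, hi, hp, hx⟩
  · left
    intro t
    rw [hWeq, hx, hagg]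
  · right
    have hyj : freeContent r P w Jp j = fun s => (freeContent r P w Jp j s -
        P i j * freeContent r P w Jp i s) + P i j * freeContent r P w Jp i s := by
      ext s; ring
    refine ⟨fun s => freeContent r P w Jp j s - P i j * freeContent r P w Jp i s,
      freeContent r P w Jp i, P i j, P i j * r i - r j, hp, ?_, hJp.freeContent w i,
      fun a b hab => ?_, hyj, fun s => ?_⟩
    · have := hrate i j hp
      rw [div_lt_iff₀ (h.rate_pos i)] at this
      linarith
    · have ea := h.feed_eq w Jp a j
      have eb := h.feed_eq w Jp b j
      rw [hx, hx] at ea eb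
      have := hmono j (lt_of_le_of_lt (Nat.zero_le _) hi) hab
      dsimp only at this ⊢
      rw [ea, eb]
      linarith
    · rw [← hyj, hWeq, hx, hagg, hagg]
      simp only [reflected]
      ring

/-- Aggregated content is own content plus a nonnegative multiple of the feeder's. -/
theorem IsSkorokhodSolution.eq_zero_of_reflected_eq_zero (j : Fin n) {s : ℝ≥0}
    (h0 : reflected (freeContent r P w Jp j) s = 0) : W s j = 0 := by
  rcases hS.feed_cases h hrate hmono hJp hJ0 hw j with hc | ⟨A, u, p, κ, hp, -, hu, -, hy, hW⟩
  · rw [hc, h0]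
  · have h1 := mul_nonneg hp.le (hu.reflected_nonneg s)
    have h2 : 0 ≤ W s j := hS.nonneg s j
    rw [hW] at h2 ⊢
    rw [hy] at h0
    simp only [reflected] at h0 h1
    linarith

/-- The zero sets may differ, but an extra zero of `W` is a left-limit zero of the aggregated
content, hence a limit of its zeros, and the suprema agree. -/
theorem IsSkorokhodSolution.busyAge_eq (hZ : ∀ j, ZerosAccumulate (freeContent r P w Jp j))
    (t : ℝ≥0) : busyAge W t = busyAge (aggregate P W) t := by
  funext j
  have hagg := hS.aggregate_eq_reflected h (fun i j hp => (hrate i j hp).le) hmono hJp hJ0 hw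
  simp only [busyAge, hagg]
  congr 1
  have hb : BddAbove {s | s ≤ t ∧ reflected (freeContent r P w Jp j) s = 0} := ⟨t, fun s hs => hs.1⟩
  refine le_antisymm (csSup_le' fun s hs => ?_) (csSup_le' fun s hs => ?_)
  · by_cases h0 : reflected (freeContent r P w Jp j) s = 0
    · exact le_csSup hb ⟨hs.1, h0⟩
    rcases hS.feed_cases h hrate hmono hJp hJ0 hw j with hc | ⟨A, u, p, κ, hp, hκ, hu, hA, hy, hW⟩
    · exact absurd ((hc s).symm.trans hs.2) h0
    rcases eq_or_lt_of_le (zero_le : 0 ≤ s) with hs0 | hs0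
    · rw [← hs0]; exact zero_le
    have hlim : Tendsto (reflected (freeContent r P w Jp j)) (𝓝[<] s) (𝓝 0) := by
      have hyc := hJp.freeContent (r := r) (P := P) w j
      rw [hy] at h0 hyc ⊢
      exact tendsto_reflected_of_feed hu hyc hp hκ hA (fun v => (hW v) ▸ hS.nonneg v j) hs0
        ((hW s).symm.trans hs.2) h0
    refine le_of_forall_lt fun a ha => ?_
    obtain ⟨v, hv, hv0⟩ := hZ j s hs0 hlim h0 a ha
    exact hv.1.trans_le (le_csSup hb ⟨hv.2.le.trans hs.1, hv0⟩)
  · exact le_csSup ⟨t, fun s hs => hs.1⟩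
      ⟨hs.1, hS.eq_zero_of_reflected_eq_zero h hrate hmono hJp hJ0 hw j hs.2⟩

/-- After the last nonzero time of `W` the aggregated content vanishes on an open interval ending at
`t`; the jump hypothesis extends this to `t`. -/
theorem IsSkorokhodSolution.idleAge_eq {t : ℝ≥0}
    (hj : 0 < t → ∀ j l, Tendsto (freeContent r P w Jp j) (𝓝[<] t) (𝓝 l) →
      freeContent r P w Jp j t ≤ l) : idleAge W t = idleAge (aggregate P W) t := by
  funext j
  have hagg := hS.aggregate_eq_reflected h (fun i j hp => (hrate i j hp).le) hmono hJp hJ0 hw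
  simp only [idleAge, hagg]
  congr 2
  have hyc := hJp.freeContent (r := r) (P := P) w j
  set a := sSup {s | s ≤ t ∧ W s j ≠ 0} with ha
  refine le_antisymm (csSup_le' fun s hs => ?_) (csSup_le' fun s hs => ?_)
  · exact le_csSup ⟨t, fun s hs => hs.1⟩ ⟨hs.1, fun h0 =>
      hs.2 (hS.eq_zero_of_reflected_eq_zero h hrate hmono hJp hJ0 hw j h0)⟩
  · by_contra hc
    rw [not_le] at hc
    have hat : a < t := hc.trans_le hs.1
    have hWz : ∀ v ∈ Ioc a t, W v j = 0 := fun v hv => by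
      by_contra hne
      exact (le_csSup (⟨t, fun s hs => hs.1⟩ : BddAbove {s | s ≤ t ∧ W s j ≠ 0})
        ⟨hv.2, hne⟩).not_gt hv.1
    rcases hS.feed_cases h hrate hmono hJp hJ0 hw j with hcs | ⟨A, u, p, κ, hp, hκ, hu, hA, hy, hW⟩
    · exact hs.2 ((hcs s).symm.trans (hWz s ⟨hc, hs.1⟩))
    have hz : ∀ v ∈ Ioo a t, reflected (freeContent r P w Jp j) v = 0 := by
      have hyc' := hyc
      rw [hy] at hyc' ⊢
      exact reflected_eq_zero_of_feed hu hyc' hκ hA fun v hv =>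
        (hW v).symm.trans (hWz v ⟨hv.1, hv.2.le⟩)
    rcases hs.1.eq_or_lt with rfl | hst
    · exact hs.2 (hyc.reflected_eq_zero_of_left hat hz
        (hj (lt_of_le_of_lt zero_le hat) j))
    · exact hs.2 (hz s ⟨hc, hst⟩)

end Compare

/-! ### The network functional and its limit in distribution. -/

section Functional

variable {n : ℕ} (P : Matrix (Fin n) (Fin n) ℝ) (c : Fin n → ℝ) (t : ℝ≥0)

/-- Contents, ages of the busy periods and ages of the idle periods as a functional of the
time-reversed free path. -/
noncomputable def networkFun (p : ℝ≥0 → Fin n → ℝ) :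
    (Fin n → ℝ) × (Fin n → ℝ≥0) × (Fin n → ℝ≥0∞) :=
  ((1 - Pᵀ) *ᵥ (fun k => contentFun (fun s => p s k) (c k) t),
    fun k => busyFun (fun s => p s k) (c k) t, fun k => idleFun (fun s => p s k) (c k) t)

theorem measurable_networkFun : Measurable (networkFun P c t) := by
  classical
  have he : ∀ s k, Measurable fun p : ℝ≥0 → Fin n → ℝ => p s k := fun s k =>
    (measurable_pi_apply k).comp (measurable_pi_apply s)
  have h1 : ∀ k, Measurable fun p : ℝ≥0 → Fin n → ℝ => contentFun (fun s => p s k) (c k) t :=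
    fun k => ((he t k).const_add (c k)).max (Measurable.iSup fun i => he _ k)
  have hcont : Continuous fun x : Fin n → ℝ => (1 - Pᵀ) *ᵥ x := by fun_prop
  refine (hcont.measurable.comp (measurable_pi_lambda _ h1)).prodMk
    ((measurable_pi_lambda _ fun k => ?_).prodMk (measurable_pi_lambda _ fun k => ?_))
  · refine Measurable.iInf fun i => Measurable.ite (measurableSet_le (h1 k)
      (Measurable.iSup fun m => ?_)) measurable_const measurable_const
    split_ifs
    · exact he _ k
    · exact measurable_const
  · refine Measurable.iSup fun i => Measurable.ite ?_ measurable_const measurable_const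
    refine (MeasurableSet.const _).inter ?_
    have : {p : ℝ≥0 → Fin n → ℝ | ∀ m, gridTime m < gridTime i →
        c k + p t k ≤ p (gridTime m) k ∧
          ∀ l, gridTime m ≤ gridTime l → p (gridTime l) k ≤ p (gridTime m) k} =
        ⋂ m, ⋂ _ : gridTime m < gridTime i, ({p | c k + p t k ≤ p (gridTime m) k} ∩
          ⋂ l, ⋂ _ : gridTime m ≤ gridTime l, {p | p (gridTime l) k ≤ p (gridTime m) k}) := by
      ext p; simp
    refine (congrArg MeasurableSet this).mpr ?_
    exact MeasurableSet.iInter fun m => MeasurableSet.iInter fun _ =>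
      (measurableSet_le ((he t k).const_add _) (he _ k)).inter
        (MeasurableSet.iInter fun l => MeasurableSet.iInter fun _ =>
          measurableSet_le (he _ k) (he _ k))

end Functional

section Limit

variable {Ω : Type*} [MeasurableSpace Ω] {n : ℕ} {μ : Measure Ω} [IsProbabilityMeasure μ]
  {X : ℝ≥0 → Ω → Fin n → ℝ}

/-- A functional of the time-reversed path of a Lévy process drifting to `-∞` converges in
distribution to the limit of the functional along the path itself. -/
theorem IsLevyProcess.tendstoInDistribution_networkFun (hX : IsLevyProcess X μ)
    (hdrift : ∀ k, ∀ᵐ ω ∂μ, Tendsto (fun t => X t ω k) atTop atBot)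
    (P : Matrix (Fin n) (Fin n) ℝ) (c : Fin n → ℝ)
    {T : ℝ≥0 → Ω → (Fin n → ℝ) × (Fin n → ℝ≥0) × (Fin n → ℝ≥0∞)}
    (hT : ∀ t, ∀ᵐ ω ∂μ, T t ω = networkFun P c t fun s => X t ω - X (t - s) ω) :
    TendstoInDistribution T atTop
      (fun ω => ((1 - Pᵀ) *ᵥ pathMax (fun t => X t ω), maxEpoch (fun t => X t ω),
        lastPassageStart (fun t => X t ω))) (fun _ => μ) μ := by
  have hm1 : ∀ t, Measurable fun ω (s : ℝ≥0) => X t ω - X (t - s) ω := fun t =>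
    measurable_pi_lambda _ fun s => (hX.measurable _).sub (hX.measurable _)
  have hm2 : ∀ t : ℝ≥0, Measurable fun ω (s : ℝ≥0) => X (min s t) ω := fun t =>
    measurable_pi_lambda _ fun s => hX.measurable _
  have hYm : ∀ t : ℝ≥0, Measurable fun ω => networkFun P c t fun s => X (min s t) ω := fun t =>
    (measurable_networkFun P c t).comp (hm2 t)
  have hlim : ∀ᵐ ω ∂μ, Tendsto (fun t : ℝ≥0 => networkFun P c t fun s => X (min s t) ω) atTop
      (𝓝 ((1 - Pᵀ) *ᵥ pathMax (fun t => X t ω), maxEpoch (fun t => X t ω),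
        lastPassageStart (fun t => X t ω))) := by
    filter_upwards [ae_all_iff.2 hdrift, hX.cadlag, hX.zero] with ω h1 h2 h3
    have h0 : ∀ k, X 0 ω k = 0 := fun k => by rw [h3]; rfl
    have hcont : Continuous fun x : Fin n → ℝ => (1 - Pᵀ) *ᵥ x := by fun_prop
    refine Tendsto.prodMk_nhds ((hcont.tendsto _).comp (tendsto_pi_nhds.2 fun k => ?_))
      (Tendsto.prodMk_nhds (tendsto_pi_nhds.2 fun k => ?_) (tendsto_pi_nhds.2 fun k => ?_))
    · exact (h2.apply k).tendsto_contentFun (h1 k) (h0 k) (c k)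
    · exact (h2.apply k).tendsto_busyFun (h1 k) (h0 k) (c k)
    · exact (h2.apply k).tendsto_idleFun (h1 k) (c k)
  -- Measurability of the limit triplet is inherited from the approximations.
  have hZ := aemeasurable_of_tendsto_metrizable_ae atTop (fun t => (hYm t).aemeasurable) hlim
  have hY := tendstoInDistribution_of_ae_tendsto (fun t => (hYm t).aemeasurable) hZ hlim
  refine ⟨fun t => ((measurable_networkFun P c t).comp (hm1 t)).aemeasurable.congr
    ((hT t).mono fun ω h => h.symm), hZ, ?_⟩
  refine hY.tendsto.congr fun t => Subtype.ext ?_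
  change μ.map (fun ω => networkFun P c t fun s => X (min s t) ω) = μ.map (T t)
  rw [Measure.map_congr (hT t)]
  have e1 := Measure.map_map (μ := μ) (measurable_networkFun P c t) (hm1 t)
  have e2 := Measure.map_map (μ := μ) (measurable_networkFun P c t) (hm2 t)
  rw [hX.map_reversed t] at e1
  exact e2.symm.trans e1

end Limit

theorem proposition5p2 {Ω : Type*} [MeasurableSpace Ω] (μ : Measure Ω) [IsProbabilityMeasure μ]
    (n : ℕ) (J : ℝ≥0 → Ω → Fin n → ℝ) (r : Fin n → ℝ) (P : Matrix (Fin n) (Fin n) ℝ)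
    (hnet : IsTreeFluidNetwork μ J r P)
    (hmono : ∀ j : Fin n, 0 < (j : ℕ) → ∀ᵐ ω ∂μ, Monotone fun t => J t ω j)
    (hint : ∀ t, Integrable (J t) μ)
    (hstable : ∀ j, ((1 - Pᵀ)⁻¹ *ᵥ fun i => ∫ ω, J 1 ω i ∂μ) j < r j)
    (w : Fin n → ℝ) (hw : 0 ≤ w)
    (W L : ℝ≥0 → Ω → Fin n → ℝ)
    (hWL : ∀ᵐ ω ∂μ, IsSkorokhodSolution (1 - Pᵀ) w (netInput r P fun t => J t ω)
      (fun t => W t ω) (fun t => L t ω)) :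
    ((∀ i j, 0 < P i j → r j / r i < P i j) →
      TendstoInDistribution
        (fun (t : ℝ≥0) ω =>
          (W t ω, busyAge (fun s => W s ω) t, idleAge (fun s => W s ω) t))
        atTop
        (fun ω => ((1 - Pᵀ) *ᵥ pathMax (netFree r P fun t => J t ω),
          maxEpoch (netFree r P fun t => J t ω),
          lastPassageStart (netFree r P fun t => J t ω)))
        (fun _ => μ) μ) ∧
    ((∀ i j, 0 < P i j → r j / r i ≤ P i j) →
      TendstoInDistribution
        (fun (t : ℝ≥0) ω =>
          (W t ω, busyAge (aggregate P fun s => W s ω) t,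
            idleAge (aggregate P fun s => W s ω) t))
        atTop
        (fun ω => ((1 - Pᵀ) *ᵥ pathMax (netFree r P fun t => J t ω),
          maxEpoch (netFree r P fun t => J t ω),
          lastPassageStart (netFree r P fun t => J t ω)))
        (fun _ => μ) μ) := by
  set X : ℝ≥0 → Ω → Fin n → ℝ := fun t ω => netFree r P (fun s => J s ω) t with hXdef
  have hX : IsLevyProcess X μ := hnet.levy.netFree r P
  have hJint : ∀ i, Integrable (fun ω => J 1 ω i) μ := fun i => (hint 1).eval i
  have hXk : ∀ k, (fun ω => X 1 ω k) = fun ω => (∑ i, (1 - Pᵀ)⁻¹ k i * J 1 ω i) - r k := fun k => by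
    ext ω
    simp [hXdef, netFree, Matrix.mulVec, dotProduct]
  have hsint : ∀ k, Integrable (fun ω => ∑ i, (1 - Pᵀ)⁻¹ k i * J 1 ω i) μ := fun k =>
    integrable_finsetSum _ fun i _ => (hJint i).const_mul _
  have hdrift : ∀ k, ∀ᵐ ω ∂μ, Tendsto (fun t => X t ω k) atTop atBot := fun k => by
    refine hX.tendsto_atBot k ?_ ?_
    · rw [hXk]
      exact (hsint k).sub (integrable_const _)
    · rw [hXk, integral_sub (hsint k) (integrable_const _),
        integral_finsetSum _ fun i _ => (hJint i).const_mul _]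
      have := hstable k
      simp only [Matrix.mulVec, dotProduct] at this
      simpa [integral_const_mul] using this
  set c : Fin n → ℝ := (1 - Pᵀ)⁻¹ *ᵥ w with hc
  have hZ : ∀ᵐ ω ∂μ, ∀ j, ZerosAccumulate (freeContent r P w (fun t => J t ω) j) :=
    ae_all_iff.2 fun j => hX.ae_zerosAccumulate j (c j)
  have hmono' : ∀ᵐ ω ∂μ, ∀ j : Fin n, 0 < (j : ℕ) → Monotone fun t => J t ω j :=
    ae_all_iff.2 fun j => by
      by_cases hj : 0 < (j : ℕ)
      · filter_upwards [hmono j hj] with ω hω _ using hω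
      · exact ae_of_all _ fun ω h => absurd h hj
  -- The initial constant `c` cancels in reversed increments, so the path fed to the functional is
  -- that of `X`; `c` survives only as its parameter.
  have hweak : (∀ i j, 0 < P i j → r j / r i ≤ P i j) → ∀ t, ∀ᵐ ω ∂μ,
      (W t ω, busyAge (aggregate P fun s => W s ω) t, idleAge (aggregate P fun s => W s ω) t) =
        networkFun P c t fun s => X t ω - X (t - s) ω := by
    intro hrate t
    filter_upwards [hWL, hZ, hmono', hnet.levy.cadlag, hnet.levy.zero] with ω hS hz hm hJc hJ0
    have hagg := hS.aggregate_eq_reflected hnet hrate hm hJc hJ0 hw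
    have hy : ∀ k, IsCadlag (freeContent r P w (fun t => J t ω) k) := fun k => hJc.freeContent w k
    have hy0 : ∀ k, freeContent r P w (fun t => J t ω) k 0 = c k := fun k => by
      simp [freeContent, netFree, hJ0, hc]
    have hrev : ∀ k, (fun s => (X t ω - X (t - s) ω) k) =
        reversed (freeContent r P w (fun t => J t ω) k) t := fun k => by
      ext s
      simp [reversed, freeContent, hXdef]
    simp only [networkFun, hrev, ← hy0, (hy _).contentFun_reversed,
      (hy _).busyFun_reversed (hz _), (hy _).idleFun_reversed]
    refine Prod.ext ?_ (Prod.ext ?_ ?_)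
    · have := IsSkorokhodSolution.mulVec_aggregate hnet (W := fun s => W s ω) t
      dsimp only at this ⊢
      rw [← this]
      congr 1
      ext k
      exact hagg k t
    · funext k
      simp only [busyAge, hagg]
    · funext k
      simp only [idleAge, hagg]
  refine ⟨fun hrate => ?_, fun hrate =>
    hX.tendstoInDistribution_networkFun hdrift P c (hweak hrate)⟩
  refine hX.tendstoInDistribution_networkFun hdrift P c fun t => ?_
  have hjump : ∀ᵐ ω ∂μ, 0 < t → ∀ j l,
      Tendsto (freeContent r P w (fun t => J t ω) j) (𝓝[<] t) (𝓝 l) →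
        freeContent r P w (fun t => J t ω) j t ≤ l := by
    rcases eq_or_lt_of_le (zero_le : 0 ≤ t) with h0 | h0
    · exact ae_of_all _ fun ω h => absurd h (by simp [← h0])
    · filter_upwards [ae_all_iff.2 fun j => hX.ae_not_jump_at j h0] with ω h _ j l hl
      have h1 : Tendsto (fun s => X s ω j) (𝓝[<] t) (𝓝 (l - c j)) := by
        refine (hl.sub_const (c j)).congr fun s => ?_
        simp [freeContent, hXdef, hc]
      have := h j _ h1
      simp only [freeContent, hXdef, hc] at this ⊢
      linarith
  filter_upwards [hweak (fun i j hp => (hrate i j hp).le) t, hWL, hZ, hmono', hnet.levy.cadlag,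
    hnet.levy.zero, hjump] with ω h1 hS hz hm hJc hJ0 hj
  rw [← h1, hS.busyAge_eq hnet hrate hm hJc hJ0 hw hz, hS.idleAge_eq hnet hrate hm hJc hJ0 hw hj]
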